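/- For $\Omega\subset\mathbb R$ and $\alpha\ge 0$, let $C^\alpha(\Omega)$ be the space of functions $u$ on $\Omega$ that are continuously differentiable up to order $\lfloor\alpha\rfloor$, with $u$ and all these derivatives bounded on $\Omega$, and whose derivative of order $\lfloor\alpha\rfloor$ satisfies the Hölder condition with index $\alpha-\lfloor\alpha\rfloor$, that is, $|u^{(\lfloor\alpha\rfloor)}(x)-u^{(\lfloor\alpha\rfloor)}(y)|\le C|x-y|^{\alpha-\lfloor\alpha\rfloor}$ for some constant $C$ and all distinct $x,y\in\Omega$. For $0<s<1$ let $$(-\Delta)^s u(x):=c_s\,\mathrm{P.V.}\!\int_{\mathbb R}\frac{u(x)-u(y)}{|x-y|^{1+2s}}\,dy,\qquad c_s:=\frac{s\,4^s\,\Gamma(1/2+s)}{\sqrt\pi\,\Gamma(1-s)},$$ where the principal value is the limit as $\delta\downarrow0$ of the integrals over $\{|x-y|>\delta\}$. **Theorem 1.2.** Let $0<s<1$, $0<\beta<1$ and $L>0$. (i) If $2s\le 1-\beta$, then there exists a $2L$-periodic function $u\in C^{2s/(1-\beta)}(\mathbb R)$ such that, for some $f\in C^\beta(\mathbb R)$,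 the principal value $(-\Delta)^su(x)$ exists and equals $f(u(x))$ for every $x\in\mathbb R$, and such that $u\notin C^{2s/(1-\beta)+\varepsilon}([-\rho,\rho])$ for all $\varepsilon>0$ and $\rho>0$. (ii) If $2s>1-\beta$, then there exists a $2L$-periodic function $u\in C^{2s+\beta}(\mathbb R)$ such that, for some $f\in C^\beta(\mathbb R)$, the principal value $(-\Delta)^su(x)$ exists and equals $f(u(x))$ for every $x\in\mathbb R$, and such that $u\notin C^{2s+\beta+\varepsilon}([-\rho,\rho])$ for all $\varepsilon>0$ and $\rho>0$. -/

import Mathlib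

open Set Filter Topology MeasureTheory

/-- `IsHolder α Ω u` says that `u` belongs to `C^α(Ω)`, for `Ω ⊆ ℝ` and `α ≥ 0`: on `Ω`, the
function `u` is continuously differentiable up to order `⌊α⌋`, its derivatives up to order `⌊α⌋`
(including `u` itself) are bounded, and the derivative of order `⌊α⌋` satisfies the Hölder
condition with index `α - ⌊α⌋`. Derivatives are taken within `Ω`, hence one-sided at the
endpoints of a compact interval. -/
def IsHolder (α : ℝ) (Ω : Set ℝ) (u : ℝ → ℝ) : Prop :=
  ContDiffOn ℝ (⌊α⌋₊ : ℕ) u Ω ∧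
  (∀ k : ℕ, k ≤ ⌊α⌋₊ → ∃ C : ℝ, ∀ x ∈ Ω, |iteratedDerivWithin k u Ω x| ≤ C) ∧
  ∃ C : NNReal, HolderOnWith C (α - ⌊α⌋₊).toNNReal (iteratedDerivWithin ⌊α⌋₊ u Ω) Ω

/-- The normalizing constant `c_s = s 4^s Γ(1/2 + s) / (√π Γ(1 - s))`. -/
noncomputable def fracLaplacianConst (s : ℝ) : ℝ :=
  s * (4 : ℝ) ^ s * Real.Gamma (1 / 2 + s) / (Real.sqrt Real.pi * Real.Gamma (1 - s))

/-- `HasFracLaplacian s u x v` says that the principal value integral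
`c_s P.V. ∫ (u x - u y) / |x - y| ^ (1 + 2 s) dy` defining `(-Δ)^s u(x)` exists and equals `v`:
the integrand is integrable on `{y | δ < |x - y|}` for every `δ > 0`, and `c_s` times the
truncated integrals tend to `v` as `δ → 0⁺`. -/
def HasFracLaplacian (s : ℝ) (u : ℝ → ℝ) (x v : ℝ) : Prop :=
  (∀ δ : ℝ, 0 < δ →
    IntegrableOn (fun y : ℝ => (u x - u y) / |x - y| ^ (1 + 2 * s)) {y : ℝ | δ < |x - y|}) ∧
  Tendsto
    (fun δ : ℝ => fracLaplacianConst s *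
      ∫ y in {y : ℝ | δ < |x - y|}, (u x - u y) / |x - y| ^ (1 + 2 * s))
    (𝓝[>] 0) (𝓝 v)

/-! Let `γ` be the target exponent, `2s/(1-β)` in (i) and `2s+β` in (ii). The solution is `u(x) =
∑_{j,i} w_j (2i+1)^(-1-γ-η_j) sin((2i+1)πx/L)` with `w_j > 0` and `η_j = h/(j+1)` decreasing to `0`.
Since each `η_j` is positive and the weights are small, coefficient times frequency to the power `γ`
is still summable, so `u` is `C^γ`, also for integer `γ` (`isHolder_oddSeries`). Since `η_j → 0`,
nothing better holds: with `m = ⌊γ⌋`, layer `j` alone forces `|u^(m)(x) - u^(m)(0)| ≥ c x^(γ-m+η_j)`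
along points `x → 0`, the other layers contributing with the same sign (`not_isHolder_oddSeries`).

The operator multiplies a sine of frequency `κ` by a constant times `κ^(2s)`, so `(-Δ)^s u` is a
constant multiple of the same series with `γ` replaced by `γ-2s` (`hasFracLaplacian_trigSeries`).
Both series are increasing functions of the single variable `S = sin(πx/L)`, because `∑
(2i+1)^(-1-θ) sin((2i+1)x) = (2Γ(θ))⁻¹ ∫_0^∞ t^(θ-1) arctan(sin x / sinh t) dt`
(`hasSum_odd_rpow_mul_sin`). This makes `(-Δ)^s u` a function of `u`.

It remains to bound increments in `S` of the second function by `C` times the `β`-th power of those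
of the first. In (i), where `γ-2s = γβ`, this is an interpolation obtained by cutting the integral
at an optimal `t` (`oddSineSum_sub_le_rpow_of_sub_eq_mul`). In (ii), where `γ-2s = β`, the second
function is `β`-Hölder in `S`, while the first grows at least linearly
(`oddSineSum_sub_le_rpow_of_sub_eq`). A Hölder extension from the range of `u` to the line gives `f`
(`exists_isHolder_comp_eq`). -/

/-! ### Sine series with nonnegative coefficients and their derivatives. -/

/-- The `n`-th formal derivative of the sine series `∑ a i * sin (κ i * x)`. -/
noncomputable def trigSeries {ι : Type*} (a κ : ι → ℝ) (n : ℕ) (x : ℝ) : ℝ :=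
  ∑' i, a i * κ i ^ n * Real.sin (κ i * x + n * (Real.pi / 2))

section TrigSeries

variable {ι : Type*} {a κ : ι → ℝ}

theorem norm_trigSeries_term_le (ha : ∀ i, 0 ≤ a i) (hκ : ∀ i, 0 ≤ κ i) (n : ℕ) (x : ℝ) (i : ι) :
    ‖a i * κ i ^ n * Real.sin (κ i * x + n * (Real.pi / 2))‖ ≤ a i * κ i ^ n := by
  have h : 0 ≤ a i * κ i ^ n := mul_nonneg (ha i) (pow_nonneg (hκ i) n)
  rw [norm_mul, Real.norm_of_nonneg h]
  exact mul_le_of_le_one_right h (Real.abs_sin_le_one _)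

theorem summable_trigSeries_term (ha : ∀ i, 0 ≤ a i) (hκ : ∀ i, 0 ≤ κ i) {n : ℕ}
    (hs : Summable fun i => a i * κ i ^ n) (x : ℝ) :
    Summable fun i => a i * κ i ^ n * Real.sin (κ i * x + n * (Real.pi / 2)) :=
  hs.of_norm_bounded (norm_trigSeries_term_le ha hκ n x)

theorem abs_trigSeries_le (ha : ∀ i, 0 ≤ a i) (hκ : ∀ i, 0 ≤ κ i) {n : ℕ}
    (hs : Summable fun i => a i * κ i ^ n) (x : ℝ) :
    |trigSeries a κ n x| ≤ ∑' i, a i * κ i ^ n :=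
  tsum_of_norm_bounded hs.hasSum (norm_trigSeries_term_le ha hκ n x)

theorem continuous_trigSeries (ha : ∀ i, 0 ≤ a i) (hκ : ∀ i, 0 ≤ κ i) {n : ℕ}
    (hs : Summable fun i => a i * κ i ^ n) : Continuous (trigSeries a κ n) :=
  continuous_tsum (fun _ => by fun_prop) hs fun i x => norm_trigSeries_term_le ha hκ n x i

theorem hasDerivAt_trigSeries (ha : ∀ i, 0 ≤ a i) (hκ : ∀ i, 0 ≤ κ i) {n : ℕ}
    (hs : Summable fun i => a i * κ i ^ n) (hs' : Summable fun i => a i * κ i ^ (n + 1)) (x : ℝ) :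
    HasDerivAt (trigSeries a κ n) (trigSeries a κ (n + 1) x) x := by
  refine hasDerivAt_tsum
    (g := fun i x => a i * κ i ^ n * Real.sin (κ i * x + n * (Real.pi / 2)))
    (g' := fun i x => a i * κ i ^ (n + 1) * Real.sin (κ i * x + (n + 1 : ℕ) * (Real.pi / 2)))
    (y₀ := 0) hs' (fun i y => ?_)
    (fun i y => norm_trigSeries_term_le ha hκ (n + 1) y i)
    (summable_trigSeries_term ha hκ hs 0) x
  have h1 : HasDerivAt (fun y => κ i * y + n * (Real.pi / 2)) (κ i) y := by
    simpa using ((hasDerivAt_id y).const_mul (κ i)).add_const (n * (Real.pi / 2))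
  refine (h1.sin.const_mul (a i * κ i ^ n)).congr_deriv ?_
  have : κ i * y + ((n + 1 : ℕ) : ℝ) * (Real.pi / 2)
      = κ i * y + n * (Real.pi / 2) + Real.pi / 2 := by push_cast; ring
  rw [this, Real.sin_add_pi_div_two]
  ring

theorem iteratedDeriv_trigSeries (ha : ∀ i, 0 ≤ a i) (hκ : ∀ i, 0 ≤ κ i) {m : ℕ}
    (hs : ∀ n ≤ m, Summable fun i => a i * κ i ^ n) {n : ℕ} (hn : n ≤ m) :
    iteratedDeriv n (trigSeries a κ 0) = trigSeries a κ n := by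
  induction n with
  | zero => exact iteratedDeriv_zero
  | succ n ih =>
    rw [iteratedDeriv_succ, ih (by omega)]
    exact funext fun x => (hasDerivAt_trigSeries ha hκ (hs n (by omega)) (hs _ hn) x).deriv

theorem contDiff_trigSeries (ha : ∀ i, 0 ≤ a i) (hκ : ∀ i, 0 ≤ κ i) {m : ℕ}
    (hs : ∀ n ≤ m, Summable fun i => a i * κ i ^ n) : ContDiff ℝ m (trigSeries a κ 0) := by
  refine contDiff_iff_iteratedDeriv (n := (m : ℕ∞)).2 ⟨fun n hn => ?_, fun n hn => ?_⟩
  · have hn : n ≤ m := by exact_mod_cast hn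
    rw [iteratedDeriv_trigSeries ha hκ hs hn]
    exact continuous_trigSeries ha hκ (hs n hn)
  · have hn : n < m := by exact_mod_cast hn
    rw [iteratedDeriv_trigSeries ha hκ hs hn.le]
    exact fun x => (hasDerivAt_trigSeries ha hκ (hs n hn.le) (hs _ hn) x).differentiableAt

theorem abs_trigSeries_sub_le (ha : ∀ i, 0 ≤ a i) (hκ : ∀ i, 0 ≤ κ i) {n : ℕ}
    (hs : Summable fun i => a i * κ i ^ n) (x y : ℝ) :
    |trigSeries a κ n x - trigSeries a κ n y|
      ≤ ∑' i, a i * κ i ^ n * min 2 (κ i * |x - y|) := by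
  have hx := summable_trigSeries_term ha hκ hs x
  have hy := summable_trigSeries_term ha hκ hs y
  have hnn : ∀ i, 0 ≤ a i * κ i ^ n := fun i => mul_nonneg (ha i) (pow_nonneg (hκ i) n)
  have hmin : ∀ i, 0 ≤ min 2 (κ i * |x - y|) := fun i =>
    le_min zero_le_two (mul_nonneg (hκ i) (abs_nonneg _))
  have hsum : Summable fun i => a i * κ i ^ n * min 2 (κ i * |x - y|) :=
    (hs.mul_right 2).of_nonneg_of_le (fun i => mul_nonneg (hnn i) (hmin i))
      fun i => mul_le_mul_of_nonneg_left (min_le_left _ _) (hnn i)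
  rw [trigSeries, trigSeries, ← hx.tsum_sub hy]
  refine tsum_of_norm_bounded (f := fun i => a i * κ i ^ n * Real.sin (κ i * x + n * (Real.pi / 2)) -
    a i * κ i ^ n * Real.sin (κ i * y + n * (Real.pi / 2))) hsum.hasSum fun i => ?_
  rw [← mul_sub, norm_mul, Real.norm_of_nonneg (hnn i)]
  refine mul_le_mul_of_nonneg_left (le_min ?_ ?_) (hnn i)
  · calc _ ≤ ‖Real.sin (κ i * x + n * (Real.pi / 2))‖ + ‖Real.sin (κ i * y + n * (Real.pi / 2))‖ :=
          norm_sub_le _ _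
      _ ≤ 1 + 1 := add_le_add (Real.abs_sin_le_one _) (Real.abs_sin_le_one _)
      _ = 2 := by norm_num
  · have := Real.lipschitzWith_sin.dist_le_mul
      (κ i * x + n * (Real.pi / 2)) (κ i * y + n * (Real.pi / 2))
    rw [Real.dist_eq, Real.dist_eq] at this
    rw [Real.norm_eq_abs]
    refine this.trans (le_of_eq ?_)
    rw [show κ i * x + n * (Real.pi / 2) - (κ i * y + n * (Real.pi / 2)) = κ i * (x - y) by ring,
      abs_mul, abs_of_nonneg (hκ i)]
    simp

end TrigSeries

/-! ### Hölder classes expressed by real inequalities. -/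

theorem holderOnWith_of_abs_sub_le {C r : ℝ} (hr : 0 ≤ r) {Ω : Set ℝ} {f : ℝ → ℝ}
    (h : ∀ x ∈ Ω, ∀ y ∈ Ω, |f x - f y| ≤ C * |x - y| ^ r) :
    HolderOnWith C.toNNReal r.toNNReal f Ω := by
  intro x hx y hy
  have h1 : |f x - f y| ≤ C.toNNReal * |x - y| ^ r :=
    (h x hx y hy).trans (mul_le_mul_of_nonneg_right (Real.le_coe_toNNReal C) (by positivity))
  rw [edist_dist, edist_dist, Real.dist_eq, Real.dist_eq, Real.coe_toNNReal r hr,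
    ENNReal.ofReal_rpow_of_nonneg (abs_nonneg _) hr, ← ENNReal.ofReal_coe_nnreal,
    ← ENNReal.ofReal_mul (by positivity)]
  exact ENNReal.ofReal_le_ofReal h1

theorem HolderOnWith.abs_sub_le {C : NNReal} {r : ℝ} (hr : 0 ≤ r) {Ω : Set ℝ} {f : ℝ → ℝ}
    (h : HolderOnWith C r.toNNReal f Ω) {x y : ℝ} (hx : x ∈ Ω) (hy : y ∈ Ω) :
    |f x - f y| ≤ C * |x - y| ^ r := by
  simpa [Real.dist_eq, Real.coe_toNNReal r hr] using h.dist_le hx hy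

theorem isHolder_trigSeries {ι : Type*} {a κ : ι → ℝ} (ha : ∀ i, 0 ≤ a i) (hκ : ∀ i, 0 ≤ κ i)
    {γ : ℝ} (hγ : 0 ≤ γ) (hs : ∀ n ≤ ⌊γ⌋₊, Summable fun i => a i * κ i ^ n)
    (hH : 0 < γ - ⌊γ⌋₊ → ∃ C, ∀ h, 0 ≤ h →
      ∑' i, a i * κ i ^ ⌊γ⌋₊ * min 2 (κ i * h) ≤ C * h ^ (γ - ⌊γ⌋₊)) :
    IsHolder γ univ (trigSeries a κ 0) := by
  have hfl : (⌊γ⌋₊ : ℝ) ≤ γ := Nat.floor_le hγ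
  refine ⟨(contDiff_trigSeries ha hκ hs).contDiffOn, fun k hk => ?_, ?_⟩
  · rw [iteratedDerivWithin_univ, iteratedDeriv_trigSeries ha hκ hs hk]
    exact ⟨_, fun x _ => abs_trigSeries_le ha hκ (hs k hk) x⟩
  · rw [iteratedDerivWithin_univ, iteratedDeriv_trigSeries ha hκ hs le_rfl]
    have key : ∃ C, ∀ x ∈ (univ : Set ℝ), ∀ y ∈ (univ : Set ℝ),
        |trigSeries a κ ⌊γ⌋₊ x - trigSeries a κ ⌊γ⌋₊ y| ≤ C * |x - y| ^ (γ - ⌊γ⌋₊) := by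
      rcases hfl.lt_or_eq with hlt | heq
      · obtain ⟨C, hC⟩ := hH (sub_pos.2 hlt)
        exact ⟨C, fun x _ y _ => (abs_trigSeries_sub_le ha hκ (hs _ le_rfl) x y).trans
          (hC _ (abs_nonneg _))⟩
      -- For integer `γ` the Hölder index is `0`, so boundedness of the top derivative is enough.
      · refine ⟨2 * ∑' i, a i * κ i ^ ⌊γ⌋₊, fun x _ y _ => ?_⟩
        rw [heq, sub_self, Real.rpow_zero, mul_one, two_mul]
        exact (abs_sub _ _).trans (add_le_add (abs_trigSeries_le ha hκ (hs _ le_rfl) x)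
          (abs_trigSeries_le ha hκ (hs _ le_rfl) y))
    obtain ⟨C, hC⟩ := key
    exact ⟨_, holderOnWith_of_abs_sub_le (sub_nonneg.2 hfl) hC⟩

/-- The Hölder condition of order `γ + ε` makes the derivative of order `⌊γ⌋` Hölder at `0`,
with an exponent larger than `γ - ⌊γ⌋`. -/
theorem IsHolder.exists_abs_iteratedDeriv_sub_le {γ ε ρ : ℝ} {u : ℝ → ℝ} (hγ : 0 ≤ γ) (hε : 0 < ε)
    (hρ : 0 < ρ) (hu : ContDiff ℝ ⌊γ⌋₊ u) (h : IsHolder (γ + ε) (Icc (-ρ) ρ) u) :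
    ∃ δ C : ℝ, 0 < δ ∧ 0 ≤ C ∧ ∀ x, 0 ≤ x → x ≤ ρ →
      |iteratedDeriv ⌊γ⌋₊ u x - iteratedDeriv ⌊γ⌋₊ u 0| ≤ C * x ^ (γ - ⌊γ⌋₊ + δ) := by
  have hU : UniqueDiffOn ℝ (Icc (-ρ) ρ) := uniqueDiffOn_Icc (by linarith)
  have h0 : (0 : ℝ) ∈ Icc (-ρ) ρ := ⟨by linarith, hρ.le⟩
  have hE : ∀ x ∈ Icc (-ρ) ρ,
      iteratedDerivWithin ⌊γ⌋₊ u (Icc (-ρ) ρ) x = iteratedDeriv ⌊γ⌋₊ u x := fun x hx =>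
    iteratedDerivWithin_eq_iteratedDeriv hU hu.contDiffAt hx
  obtain ⟨hc, hb, C, hC⟩ := h
  have hle : ⌊γ⌋₊ ≤ ⌊γ + ε⌋₊ := Nat.floor_mono (by linarith)
  rcases hle.eq_or_lt with heq | hlt
  · rw [← heq] at hC
    refine ⟨ε, C, hε, C.2, fun x hx0 hxρ => ?_⟩
    have hx : x ∈ Icc (-ρ) ρ := ⟨by linarith, hxρ⟩
    have hr : 0 ≤ γ + ε - ⌊γ⌋₊ := by linarith [Nat.floor_le hγ]
    have := hC.abs_sub_le hr hx h0
    rw [hE x hx, hE 0 h0, sub_zero, abs_of_nonneg hx0] at this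
    rwa [show γ - ⌊γ⌋₊ + ε = γ + ε - ⌊γ⌋₊ by ring]
  -- If adding `ε` reaches the next integer, the next derivative is bounded and the one of order
  -- `⌊γ⌋` is Lipschitz; `δ` is chosen to make the exponent equal to `1`.
  · obtain ⟨B, hB⟩ := hb (⌊γ⌋₊ + 1) hlt
    have hB0 : 0 ≤ B := (abs_nonneg _).trans (hB 0 h0)
    refine ⟨1 - (γ - ⌊γ⌋₊), B, by linarith [Nat.lt_floor_add_one γ], hB0, fun x hx0 hxρ => ?_⟩
    have hx : x ∈ Icc (-ρ) ρ := ⟨by linarith, hxρ⟩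
    have hd : DifferentiableOn ℝ (iteratedDerivWithin ⌊γ⌋₊ u (Icc (-ρ) ρ)) (Icc (-ρ) ρ) :=
      hc.differentiableOn_iteratedDerivWithin (by exact_mod_cast hlt) hU
    have := (convex_Icc (-ρ) ρ).norm_image_sub_le_of_norm_derivWithin_le hd (C := B)
      (fun y hy => by rw [← iteratedDerivWithin_succ]; exact hB y hy) h0 hx
    rw [hE x hx, hE 0 h0, sub_zero, Real.norm_eq_abs, Real.norm_eq_abs, abs_of_nonneg hx0] at this
    rwa [show γ - ⌊γ⌋₊ + (1 - (γ - ⌊γ⌋₊)) = 1 by ring, Real.rpow_one]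

/-! ### The fractional Laplacian of a sine series. -/

theorem integrable_comp_abs_of_integrableOn_Ioi {f : ℝ → ℝ} (hf : IntegrableOn f (Ioi 0)) :
    Integrable fun t => f |t| := by
  have h1 : IntegrableOn (fun t => f |t|) (Ioi 0) :=
    hf.congr_fun (fun t ht => by simp only [abs_of_pos (mem_Ioi.1 ht)]) measurableSet_Ioi
  have h2 : IntegrableOn (fun t => f |t|) (Iic 0) := by
    rw [integrableOn_Iic_iff_integrableOn_Iio]
    have h := (Measure.measurePreserving_neg (volume : Measure ℝ)).integrableOn_comp_preimage
      (Homeomorph.neg ℝ).measurableEmbedding (f := fun t => f |t|) (s := Ioi 0)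
    simpa [Function.comp_def] using h.2 h1
  simpa using h2.union h1

theorem integrableOn_abs_rpow_neg {p δ : ℝ} (hp : 1 < p) (hδ : 0 < δ) :
    IntegrableOn (fun t : ℝ => (|t| ^ p)⁻¹) {t | δ < |t|} := by
  have hm : MeasurableSet {t : ℝ | δ < |t|} := measurableSet_lt (by fun_prop) (by fun_prop)
  rw [← integrable_indicator_iff hm]
  have h : IntegrableOn ((Ioi δ).indicator fun t : ℝ => (t ^ p)⁻¹) (Ioi 0) := by
    refine Integrable.integrableOn ((integrable_indicator_iff measurableSet_Ioi).2 ?_)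
    refine (integrableOn_Ioi_rpow_of_lt (by linarith : -p < -1) hδ).congr_fun (fun t ht => ?_)
      measurableSet_Ioi
    exact Real.rpow_neg (hδ.le.trans (mem_Ioi.1 ht).le) p
  refine (integrable_comp_abs_of_integrableOn_Ioi h).congr (Eventually.of_forall fun t => ?_)
  by_cases ht : δ < |t| <;> simp [indicator, ht]

/-- Near `0` the bound `1 - cos t ≤ t²/2` leaves `t^(1-2s)`, integrable because `s < 1`; at infinity
the bound `2` leaves `t^(-1-2s)`, integrable because `s > 0`. -/
theorem integrable_one_sub_cos_div {s : ℝ} (hs0 : 0 < s) (hs1 : s < 1) :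
    Integrable fun t : ℝ => (1 - Real.cos t) / |t| ^ (1 + 2 * s) := by
  have key : IntegrableOn (fun t : ℝ => (1 - Real.cos t) / t ^ (1 + 2 * s)) (Ioi 0) := by
    rw [← Ioc_union_Ioi_eq_Ioi (zero_le_one' ℝ)]
    have hmeas : ∀ S : Set ℝ, AEStronglyMeasurable
        (fun t : ℝ => (1 - Real.cos t) / t ^ (1 + 2 * s)) (volume.restrict S) := fun S =>
      (by fun_prop : Measurable fun t : ℝ =>
        (1 - Real.cos t) / t ^ (1 + 2 * s)).aestronglyMeasurable
    have hnn : ∀ t : ℝ, 0 ≤ 1 - Real.cos t := fun t => sub_nonneg.2 (Real.cos_le_one t)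
    refine IntegrableOn.union ?_ ?_
    · have h := (intervalIntegral.intervalIntegrable_rpow' (a := 0) (b := 1)
        (by linarith : -1 < 1 - 2 * s)).1
      refine Integrable.mono' h (hmeas _) ((ae_restrict_iff' measurableSet_Ioc).2
        (Eventually.of_forall fun t ht => ?_))
      have ht0 : 0 < t := ht.1
      rw [Real.norm_of_nonneg (div_nonneg (hnn t) (by positivity)), div_le_iff₀ (by positivity),
        ← Real.rpow_add ht0, show 1 - 2 * s + (1 + 2 * s) = (2 : ℕ) by push_cast; ring,
        Real.rpow_natCast]
      nlinarith [Real.one_sub_sq_div_two_le_cos (x := t)]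
    · refine Integrable.mono' ((integrableOn_Ioi_rpow_of_lt (by linarith : -(1 + 2 * s) < -1)
        zero_lt_one).const_mul 2) (hmeas _) ((ae_restrict_iff' measurableSet_Ioi).2
        (Eventually.of_forall fun t ht => ?_))
      have ht0 : 0 < t := zero_lt_one.trans ht
      rw [Real.norm_of_nonneg (div_nonneg (hnn t) (by positivity)), Real.rpow_neg ht0.le,
        div_eq_mul_inv]
      exact mul_le_mul_of_nonneg_right (by linarith [Real.neg_one_le_cos t]) (by positivity)
  simpa using integrable_comp_abs_of_integrableOn_Ioi key

/-- The truncated integral of `(1 - cos t) / |t| ^ (1 + 2 s)`. -/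
noncomputable def truncatedSymbol (s δ : ℝ) : ℝ :=
  ∫ t in {t : ℝ | δ < |t|}, (1 - Real.cos t) / |t| ^ (1 + 2 * s)

theorem measurableSet_lt_abs (δ : ℝ) : MeasurableSet {t : ℝ | δ < |t|} :=
  measurableSet_lt (by fun_prop) (by fun_prop)

theorem one_sub_cos_div_nonneg (p t : ℝ) : 0 ≤ (1 - Real.cos t) / |t| ^ p :=
  div_nonneg (sub_nonneg.2 (Real.cos_le_one t)) (by positivity)

theorem abs_truncatedSymbol_le {s : ℝ} (hs0 : 0 < s) (hs1 : s < 1) (δ : ℝ) :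
    |truncatedSymbol s δ| ≤ ∫ t : ℝ, (1 - Real.cos t) / |t| ^ (1 + 2 * s) := by
  rw [truncatedSymbol, abs_of_nonneg (integral_nonneg fun t => one_sub_cos_div_nonneg _ t)]
  exact setIntegral_le_integral (integrable_one_sub_cos_div hs0 hs1)
    (Eventually.of_forall fun t => one_sub_cos_div_nonneg _ t)

theorem tendsto_truncatedSymbol {s : ℝ} (hs0 : 0 < s) (hs1 : s < 1) :
    Tendsto (truncatedSymbol s) (𝓝[>] 0)
      (𝓝 (∫ t : ℝ, (1 - Real.cos t) / |t| ^ (1 + 2 * s))) := by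
  have hI := integrable_one_sub_cos_div hs0 hs1
  have heq : truncatedSymbol s = fun δ => ∫ t : ℝ, {t : ℝ | δ < |t|}.indicator
      (fun t : ℝ => (1 - Real.cos t) / |t| ^ (1 + 2 * s)) t := by
    funext δ
    rw [integral_indicator (measurableSet_lt_abs δ), truncatedSymbol]
  rw [heq]
  refine tendsto_integral_filter_of_dominated_convergence
    (fun t => (1 - Real.cos t) / |t| ^ (1 + 2 * s))
    (Eventually.of_forall fun δ => hI.aestronglyMeasurable.indicator (measurableSet_lt_abs δ))
    (Eventually.of_forall fun δ => Eventually.of_forall fun t => ?_) hI ?_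
  · refine (norm_indicator_le_norm_self _ _).trans (le_of_eq ?_)
    exact Real.norm_of_nonneg (one_sub_cos_div_nonneg _ t)
  · have h0 : ∀ᵐ t : ℝ, t ≠ 0 := by
      simp [ae_iff]
    filter_upwards [h0] with t ht
    refine tendsto_const_nhds.congr' ?_
    have : ∀ᶠ δ in 𝓝[>] (0 : ℝ), δ < |t| :=
      nhdsWithin_le_nhds (eventually_lt_nhds (abs_pos.2 ht))
    filter_upwards [this] with δ hδ
    simp [indicator, hδ]

theorem integral_eq_zero_of_odd {f : ℝ → ℝ} (hf : ∀ t, f (-t) = -f t) : ∫ t, f t = 0 := by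
  have h := integral_neg_eq_self f volume
  simp only [hf, integral_neg] at h
  linarith

theorem integrableOn_sub_div_abs_rpow {p δ : ℝ} (hp : 1 < p) (hδ : 0 < δ) {u : ℝ → ℝ}
    (hu : Measurable u) {M : ℝ} (hM : ∀ y, |u y| ≤ M) (x : ℝ) :
    IntegrableOn (fun y : ℝ => (u x - u y) / |x - y| ^ p) {y : ℝ | δ < |x - y|} ∧
      ∫ y in {y : ℝ | δ < |x - y|}, |(u x - u y) / |x - y| ^ p|
        ≤ 2 * M * ∫ t in {t : ℝ | δ < |t|}, (|t| ^ p)⁻¹ := by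
  have hm : MeasurableSet {y : ℝ | δ < |x - y|} := measurableSet_lt (by fun_prop) (by fun_prop)
  have hk := (integrable_indicator_iff (measurableSet_lt_abs δ)).2 (integrableOn_abs_rpow_neg hp hδ)
  have hk' : IntegrableOn (fun y : ℝ => 2 * M * (|x - y| ^ p)⁻¹) {y : ℝ | δ < |x - y|} := by
    refine Integrable.const_mul (μ := volume.restrict {y : ℝ | δ < |x - y|}) ?_ _
    exact (integrable_indicator_iff hm).1 (hk.comp_sub_left x)
  have hb : ∀ y, |(u x - u y) / |x - y| ^ p| ≤ 2 * M * (|x - y| ^ p)⁻¹ := fun y => by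
    rw [abs_div, abs_of_nonneg (by positivity : 0 ≤ |x - y| ^ p), div_eq_mul_inv]
    refine mul_le_mul_of_nonneg_right ?_ (by positivity)
    linarith [abs_sub (u x) (u y), hM x, hM y]
  have hi : IntegrableOn (fun y : ℝ => (u x - u y) / |x - y| ^ p) {y : ℝ | δ < |x - y|} :=
    Integrable.mono' hk' (by
      have : Measurable fun y : ℝ => (u x - u y) / |x - y| ^ p := by fun_prop
      exact this.aestronglyMeasurable) (Eventually.of_forall hb)
  refine ⟨hi, (integral_mono hi.abs hk' hb).trans (le_of_eq ?_)⟩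
  rw [integral_const_mul, ← integral_indicator hm, ← integral_indicator (measurableSet_lt_abs δ)]
  exact congrArg (2 * M * ·) (integral_sub_left_eq_self
    ({t : ℝ | δ < |t|}.indicator fun t : ℝ => (|t| ^ p)⁻¹) volume x)

/-- With `y = x - t`, the numerator is `sin κx (1 - cos κt) + cos κx sin κt`. The second part is odd
in `t` and integrates to zero; rescaling `t` by `κ` in the first produces the factor `κ^(2s)` and
moves the cutoff to `κδ`. -/
theorem setIntegral_sin_sub_sin_div {s κ δ : ℝ} (hs0 : 0 < s) (hs1 : s < 1) (hκ : 0 < κ)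
    (hδ : 0 < δ) (x : ℝ) :
    ∫ y in {y : ℝ | δ < |x - y|}, (Real.sin (κ * x) - Real.sin (κ * y)) / |x - y| ^ (1 + 2 * s)
      = κ ^ (2 * s) * Real.sin (κ * x) * truncatedSymbol s (κ * δ) := by
  have hm : MeasurableSet {y : ℝ | δ < |x - y|} := measurableSet_lt (by fun_prop) (by fun_prop)
  have hk := (integrable_indicator_iff (measurableSet_lt_abs δ)).2
    (integrableOn_abs_rpow_neg (by linarith : 1 < 1 + 2 * s) hδ)
  set F : ℝ → ℝ := {t : ℝ | κ * δ < |t|}.indicator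
    (fun t => (1 - Real.cos t) / |t| ^ (1 + 2 * s)) with hF
  set G : ℝ → ℝ := {t : ℝ | δ < |t|}.indicator
    (fun t => Real.sin (κ * t) / |t| ^ (1 + 2 * s)) with hG
  have hFi : Integrable F :=
    (integrable_one_sub_cos_div hs0 hs1).indicator (measurableSet_lt_abs _)
  have hGi : Integrable G := by
    have hGm : Measurable G :=
      (by fun_prop : Measurable fun t : ℝ => Real.sin (κ * t) / |t| ^ (1 + 2 * s)).indicator
        (measurableSet_lt_abs δ)
    refine Integrable.mono' hk hGm.aestronglyMeasurable (Eventually.of_forall fun t => ?_)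
    by_cases ht : δ < |t|
    · simp only [hG, indicator, mem_ofPred_eq, ht, if_true]
      rw [norm_div, Real.norm_of_nonneg (by positivity : 0 ≤ |t| ^ (1 + 2 * s)), div_eq_mul_inv]
      exact mul_le_of_le_one_left (by positivity) (Real.abs_sin_le_one _)
    · simp [hG, indicator, ht]
  have hG0 : ∫ t, G t = 0 := integral_eq_zero_of_odd fun t => by
    by_cases ht : δ < |t| <;> simp [hG, ht, neg_div]
  have hFs : ∫ t, F (κ * t) = κ⁻¹ * truncatedSymbol s (κ * δ) := by
    rw [Measure.integral_comp_mul_left, hF, integral_indicator (measurableSet_lt_abs _),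
      abs_of_pos (inv_pos.2 hκ), truncatedSymbol, smul_eq_mul]
  have hpt : ∀ y : ℝ, {y : ℝ | δ < |x - y|}.indicator
      (fun y => (Real.sin (κ * x) - Real.sin (κ * y)) / |x - y| ^ (1 + 2 * s)) y
      = Real.sin (κ * x) * κ ^ (1 + 2 * s) * F (κ * (x - y)) + Real.cos (κ * x) * G (x - y) := by
    intro y
    have hiff : κ * δ < |κ * (x - y)| ↔ δ < |x - y| := by
      rw [abs_mul, abs_of_pos hκ, mul_lt_mul_iff_right₀ hκ]
    by_cases ht : δ < |x - y|
    · have hxy : 0 < |x - y| := hδ.trans ht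
      simp only [hF, hG, indicator, mem_ofPred_eq, ht, hiff.2 ht, if_true]
      rw [abs_mul, abs_of_pos hκ, Real.mul_rpow hκ.le hxy.le]
      have e1 : κ ^ (1 + 2 * s) ≠ 0 := (Real.rpow_pos_of_pos hκ _).ne'
      have e2 : |x - y| ^ (1 + 2 * s) ≠ 0 := (Real.rpow_pos_of_pos hxy _).ne'
      have e3 : Real.sin (κ * y) = Real.sin (κ * x) * Real.cos (κ * (x - y))
          - Real.cos (κ * x) * Real.sin (κ * (x - y)) := by
        rw [← Real.sin_sub]; congr 1; ring
      rw [e3]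
      field_simp
      ring
    · have ht' : ¬ κ * δ < |κ * (x - y)| := fun h => ht (hiff.1 h)
      simp only [hF, hG, indicator, mem_ofPred_eq, ht, ht', if_false]
      ring
  rw [← integral_indicator hm]
  simp_rw [hpt]
  rw [integral_sub_left_eq_self (fun t => Real.sin (κ * x) * κ ^ (1 + 2 * s) * F (κ * t)
    + Real.cos (κ * x) * G t) volume x, integral_add, integral_const_mul, integral_const_mul, hG0,
    hFs, Real.rpow_add hκ, Real.rpow_one]
  · field_simp
    ring
  · exact (hFi.comp_mul_left' hκ.ne').const_mul _
  · exact hGi.const_mul _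

/-- For fixed `δ` the kernel is integrable off the cutoff, so summability of the coefficients allows
termwise integration. As `δ → 0`, the truncated symbols are bounded by the full integral uniformly
in `δ` and the frequency, so dominated convergence applies to the sum. The value of that integral is
never needed. -/
theorem hasFracLaplacian_trigSeries {ι : Type*} [Countable ι] {a κ : ι → ℝ} {s : ℝ} (hs0 : 0 < s)
    (hs1 : s < 1) (ha : ∀ i, 0 ≤ a i) (hκ : ∀ i, 0 < κ i) (hsum : Summable a)
    (hsum' : Summable fun i => a i * κ i ^ (2 * s)) (x : ℝ) :
    HasFracLaplacian s (trigSeries a κ 0) x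
      (fracLaplacianConst s * (∫ t : ℝ, (1 - Real.cos t) / |t| ^ (1 + 2 * s)) *
        ∑' i, a i * κ i ^ (2 * s) * Real.sin (κ i * x)) := by
  have hp : 1 < 1 + 2 * s := by linarith
  have hκ' : ∀ i, 0 ≤ κ i := fun i => (hκ i).le
  have hs : Summable fun i => a i * κ i ^ 0 := by simpa using hsum
  have hterm : ∀ y, Summable fun i => a i * Real.sin (κ i * y) := fun y => by
    simpa using summable_trigSeries_term ha hκ' hs y
  have hdef : ∀ y, trigSeries a κ 0 y = ∑' i, a i * Real.sin (κ i * y) := fun y => by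
    simp [trigSeries]
  have hmeas : Measurable (trigSeries a κ 0) := (continuous_trigSeries ha hκ' hs).measurable
  refine ⟨fun δ hδ => (integrableOn_sub_div_abs_rpow hp hδ hmeas
    (abs_trigSeries_le ha hκ' hs) x).1, ?_⟩
  have htrunc : ∀ δ : ℝ, 0 < δ → ∫ y in {y : ℝ | δ < |x - y|},
      (trigSeries a κ 0 x - trigSeries a κ 0 y) / |x - y| ^ (1 + 2 * s)
      = ∑' i, a i * κ i ^ (2 * s) * Real.sin (κ i * x) * truncatedSymbol s (κ i * δ) := by
    intro δ hδ
    have hI := fun i => integrableOn_sub_div_abs_rpow hp hδ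
      (u := fun y => a i * Real.sin (κ i * y)) (by fun_prop) (M := a i) (fun y => by
        rw [abs_mul, abs_of_nonneg (ha i)]
        exact mul_le_of_le_one_right (ha i) (Real.abs_sin_le_one _)) x
    have hS := hasSum_integral_of_summable_integral_norm (fun i => (hI i).1)
      (((hsum.mul_left 2).mul_right _).of_nonneg_of_le
        (fun i => integral_nonneg fun _ => norm_nonneg _) fun i => (hI i).2)
    calc _ = ∫ y in {y : ℝ | δ < |x - y|}, ∑' i,
          (a i * Real.sin (κ i * x) - a i * Real.sin (κ i * y)) / |x - y| ^ (1 + 2 * s) := by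
          refine integral_congr_ae (Eventually.of_forall fun y => ?_)
          simp only
          rw [tsum_div_const, (hterm x).tsum_sub (hterm y), hdef, hdef]
      _ = _ := hS.tsum_eq.symm
      _ = _ := tsum_congr fun i => by
          simp_rw [← mul_sub, mul_div_assoc]
          rw [integral_const_mul, setIntegral_sin_sub_sin_div hs0 hs1 (hκ i) hδ]
          ring
  simp_rw [mul_assoc (fracLaplacianConst s)]
  refine Tendsto.const_mul _ ?_
  refine Tendsto.congr' (f₁ := fun δ => ∑' i, a i * κ i ^ (2 * s) * Real.sin (κ i * x) *
    truncatedSymbol s (κ i * δ)) ?_ ?_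
  · filter_upwards [self_mem_nhdsWithin] with δ hδ using (htrunc δ hδ).symm
  · rw [← tsum_mul_left]
    refine tendsto_tsum_of_dominated_convergence (hsum'.mul_right
      (∫ t : ℝ, (1 - Real.cos t) / |t| ^ (1 + 2 * s))) (fun i => ?_)
      (Eventually.of_forall fun δ i => ?_)
    · rw [mul_comm (∫ t : ℝ, (1 - Real.cos t) / |t| ^ (1 + 2 * s))]
      refine Tendsto.const_mul _ ((tendsto_truncatedSymbol hs0 hs1).comp ?_)
      refine tendsto_nhdsWithin_iff.2 ⟨?_, ?_⟩
      · have : Tendsto (fun δ : ℝ => κ i * δ) (𝓝 0) (𝓝 (κ i * 0)) :=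
          (continuous_const_mul (κ i)).tendsto 0
        rw [mul_zero] at this
        exact this.mono_left nhdsWithin_le_nhds
      · filter_upwards [self_mem_nhdsWithin] with δ hδ using mul_pos (hκ i) hδ
    · have h1 : 0 ≤ a i * κ i ^ (2 * s) := mul_nonneg (ha i) (Real.rpow_nonneg (hκ' i) _)
      rw [norm_mul, norm_mul, Real.norm_of_nonneg h1]
      exact mul_le_mul (mul_le_of_le_one_right h1 (Real.abs_sin_le_one _))
        (abs_truncatedSymbol_le hs0 hs1 _) (norm_nonneg _) h1

/-! ### Integral representation of the odd sine series. -/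

/-- Both `1 + z` and `1 - z` lie in the right half-plane, so their arguments are arctangents; the
addition formula applies without a shift by `π` exactly because `‖z‖ < 1`. -/
theorem arg_one_add_sub_arg_one_sub {z : ℂ} (hz : ‖z‖ < 1) :
    (1 + z).arg - (1 - z).arg = Real.arctan (2 * z.im / (1 - ‖z‖ ^ 2)) := by
  have hre : |z.re| < 1 := (Complex.abs_re_le_norm z).trans_lt hz
  obtain ⟨h1, h2⟩ := abs_lt.1 hre
  have harg : ∀ w : ℂ, 0 < w.re → w.arg = Real.arctan (w.im / w.re) := fun w hw => by
    rw [← Complex.tan_arg]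
    have h := Complex.abs_arg_lt_pi_div_two_iff.2 (Or.inl hw)
    exact (Real.arctan_tan (abs_lt.1 h).1 (abs_lt.1 h).2).symm
  have hn : ‖z‖ ^ 2 = z.re ^ 2 + z.im ^ 2 := by
    rw [← Complex.normSq_eq_norm_sq, Complex.normSq_apply]; ring
  have hn1 : z.re ^ 2 + z.im ^ 2 < 1 := by
    rw [← hn]; exact pow_lt_one₀ (norm_nonneg _) hz two_ne_zero
  have hp : 0 < 1 + z.re := by linarith
  have hm : 0 < 1 - z.re := by linarith
  rw [harg _ (by simpa using hp), harg _ (by simpa using hm)]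
  simp only [Complex.add_im, Complex.sub_im, Complex.add_re, Complex.sub_re, Complex.one_re,
    Complex.one_im, zero_add, zero_sub, neg_div, Real.arctan_neg, sub_neg_eq_add]
  have hpm : 0 < (1 + z.re) * (1 - z.re) := mul_pos hp hm
  rw [Real.arctan_add]
  · congr 1
    rw [hn]
    have : 1 - z.im / (1 + z.re) * (z.im / (1 - z.re))
        = (1 - (z.re ^ 2 + z.im ^ 2)) / ((1 + z.re) * (1 - z.re)) := by
      field_simp; ring
    have h3 : 1 - (z.re ^ 2 + z.im ^ 2) ≠ 0 := by linarith
    rw [this]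
    field_simp
    ring
  · rw [div_mul_div_comm, div_lt_one hpm]
    nlinarith

/-- This is the imaginary part of `∑ z^(2i+1)/(2i+1) = (log(1+z) - log(1-z))/2` at `z = exp(-t +
ix)`, for which `2 Im z / (1 - ‖z‖²) = sin x / sinh t`. -/
theorem hasSum_odd_exp_mul_sin {t : ℝ} (ht : 0 < t) (x : ℝ) :
    HasSum (fun i : ℕ => Real.exp (-((2 * i + 1) * t)) * Real.sin ((2 * i + 1) * x) / (2 * i + 1))
      (Real.arctan (Real.sin x / Real.sinh t) / 2) := by
  set z : ℂ := Complex.exp (-t + x * Complex.I) with hzdef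
  have hzn : ‖z‖ = Real.exp (-t) := by rw [hzdef, Complex.norm_exp]; simp
  have hz : ‖z‖ < 1 := by rw [hzn]; simpa using ht
  have hzim : z.im = Real.exp (-t) * Real.sin x := by rw [hzdef, Complex.exp_im]; simp
  have h1 := Complex.hasSum_taylorSeries_neg_log hz
  have h2 := Complex.hasSum_taylorSeries_neg_log (z := -z) (by rwa [norm_neg])
  have h3 := Complex.hasSum_im ((h1.sub h2).div_const 2)
  have hodd : Function.Injective fun i : ℕ => 2 * i + 1 := fun i j h => by simpa using h
  rw [← hodd.hasSum_iff] at h3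
  · convert h3 using 1
    · funext i
      have hpow : z ^ (2 * i + 1)
          = Complex.exp ((-((2 * i + 1) * t) : ℝ) + ((2 * i + 1) * x : ℝ) * Complex.I) := by
        rw [hzdef, ← Complex.exp_nat_mul]
        congr 1
        push_cast
        ring
      have heq : (z ^ (2 * i + 1) / ((2 * i + 1 : ℕ) : ℂ) - (-z) ^ (2 * i + 1) / ((2 * i + 1 : ℕ) : ℂ))
          / 2 = z ^ (2 * i + 1) / ((2 * i + 1 : ℝ) : ℂ) := by
        rw [Odd.neg_pow ⟨i, rfl⟩]
        push_cast
        ring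
      simp only [Function.comp]
      rw [heq, Complex.div_ofReal_im, hpow, Complex.exp_im]
      simp
    · have hlog : ((-Complex.log (1 - z) - -Complex.log (1 - -z)) / 2).im
          = ((1 + z).arg - (1 - z).arg) / 2 := by
        rw [show (2 : ℂ) = ((2 : ℝ) : ℂ) by simp, Complex.div_ofReal_im, Complex.sub_im,
          Complex.neg_im, Complex.neg_im, Complex.log_im, Complex.log_im, sub_neg_eq_add, sub_neg_eq_add]
        ring
      rw [hlog, arg_one_add_sub_arg_one_sub hz, hzn, hzim, Real.sinh_eq]
      congr 2
      have he : 1 - Real.exp (-t) ^ 2 = Real.exp (-t) * (Real.exp t - Real.exp (-t)) := by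
        have : Real.exp (-t) * Real.exp t = 1 := by rw [← Real.exp_add]; simp
        linear_combination -this
      have hne : Real.exp t - Real.exp (-t) ≠ 0 := by
        have := Real.exp_lt_exp.2 (by linarith : -t < t)
        linarith
      have hne' := (Real.exp_pos (-t)).ne'
      rw [he]
      field_simp
  · intro n hn
    have heven : Even n := by
      by_contra h
      obtain ⟨i, hi⟩ := Nat.not_even_iff_odd.1 h
      exact hn ⟨i, hi.symm⟩
    simp [heven.neg_pow]

theorem abs_arctan_sub_le (a b : ℝ) : |Real.arctan a - Real.arctan b| ≤ |a - b| := by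
  have h := convex_univ.norm_image_sub_le_of_norm_deriv_le (f := Real.arctan) (C := 1)
    (x := b) (y := a) (fun x _ => Real.differentiableAt_arctan x) (fun x _ => by
      rw [Real.deriv_arctan, Real.norm_of_nonneg (by positivity)]
      exact (div_le_one (by positivity)).2 (by nlinarith [sq_nonneg x])) (mem_univ _) (mem_univ _)
  simpa using h

theorem div_le_arctan_sub {a b M : ℝ} (ha : a ∈ Icc (-M) M) (hb : b ∈ Icc (-M) M) (hab : b ≤ a) :
    (a - b) / (1 + M ^ 2) ≤ Real.arctan a - Real.arctan b := by
  have h := (convex_Icc (-M) M).mul_sub_le_image_sub_of_le_deriv (f := Real.arctan)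
    (C := 1 / (1 + M ^ 2)) Real.continuous_arctan.continuousOn
    Real.differentiable_arctan.differentiableOn (fun x hx => by
      rw [interior_Icc] at hx
      rw [Real.deriv_arctan]
      exact one_div_le_one_div_of_le (by positivity) (by nlinarith [hx.1, hx.2])) b hb a ha hab
  rwa [one_div_mul_eq_div] at h

/-- A majorant integrable against `t^(θ-1)` at both ends: for `t ≤ 1` boundedness of the arctangent
suffices, for `t > 1` the decay of `1/sinh t`. -/
theorem abs_arctan_div_sinh_le {S t : ℝ} (hS : |S| ≤ 1) (ht : 0 < t) :
    |Real.arctan (S / Real.sinh t)| ≤ 8 * Real.exp (-t) := by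
  have hsinh : 0 < Real.sinh t := Real.sinh_pos_iff.2 ht
  rcases le_or_gt t 1 with h | h
  · have h1 : |Real.arctan (S / Real.sinh t)| ≤ 2 := by
      rw [abs_le]
      constructor <;> linarith [Real.neg_pi_div_two_lt_arctan (S / Real.sinh t),
        Real.arctan_lt_pi_div_two (S / Real.sinh t), Real.pi_le_four]
    have h2 : (1 / 4 : ℝ) ≤ Real.exp (-t) := by
      rw [Real.exp_neg, one_div]
      refine inv_anti₀ (Real.exp_pos t) ((Real.exp_le_exp.2 h).trans ?_)
      linarith [Real.exp_one_lt_d9]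
    linarith
  · have h1 : |Real.arctan (S / Real.sinh t)| ≤ |S / Real.sinh t| := by
      simpa using abs_arctan_sub_le (S / Real.sinh t) 0
    refine h1.trans ?_
    rw [abs_div, abs_of_pos hsinh, div_le_iff₀ hsinh, Real.sinh_eq]
    have h3 : Real.exp (-t) * Real.exp t = 1 := by rw [← Real.exp_add]; simp
    have h4 : 2 ≤ Real.exp t := by linarith [Real.add_one_le_exp t]
    have h5 := Real.exp_pos (-t)
    nlinarith

theorem integrableOn_rpow_mul_exp_neg {θ : ℝ} (hθ : 0 < θ) :
    IntegrableOn (fun t : ℝ => t ^ (θ - 1) * Real.exp (-t)) (Ioi 0) := by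
  simpa only [mul_comm] using Real.GammaIntegral_convergent hθ

theorem integrableOn_rpow_mul_arctan {θ S : ℝ} (hθ : 0 < θ) (hS : |S| ≤ 1) :
    IntegrableOn (fun t : ℝ => t ^ (θ - 1) * Real.arctan (S / Real.sinh t)) (Ioi 0) := by
  have hm : Measurable fun t : ℝ => t ^ (θ - 1) * Real.arctan (S / Real.sinh t) :=
    (by fun_prop : Measurable fun t : ℝ => t ^ (θ - 1)).mul
      (Real.measurable_arctan.comp (measurable_const.div Real.measurable_sinh))
  refine Integrable.mono' ((integrableOn_rpow_mul_exp_neg hθ).const_mul 8)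
    hm.aestronglyMeasurable ((ae_restrict_iff' measurableSet_Ioi).2
      (Eventually.of_forall fun t (ht : 0 < t) => ?_))
  rw [norm_mul, Real.norm_of_nonneg (by positivity : 0 ≤ t ^ (θ - 1))]
  calc t ^ (θ - 1) * ‖Real.arctan (S / Real.sinh t)‖ ≤ t ^ (θ - 1) * (8 * Real.exp (-t)) :=
        mul_le_mul_of_nonneg_left (abs_arctan_div_sinh_le hS ht) (by positivity)
    _ = _ := by ring

/-- The integral representing `∑ (2 i + 1) ^ (-1 - θ) * sin ((2 i + 1) x)` in terms of
`S = sin x`. -/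
noncomputable def oddSineIntegral (θ S : ℝ) : ℝ :=
  (∫ t in Ioi (0 : ℝ), t ^ (θ - 1) * Real.arctan (S / Real.sinh t)) / (2 * Real.Gamma θ)

theorem summable_odd_rpow {p : ℝ} (hp : p < -1) : Summable fun i : ℕ => (2 * i + 1 : ℝ) ^ p := by
  have hodd : Function.Injective fun i : ℕ => 2 * i + 1 := fun i j h => by simpa using h
  have h := (Real.summable_nat_rpow.2 hp).comp_injective hodd
  simpa [Function.comp_def] using h

/-- Write `(2i+1)^(-θ) Γ(θ)` as the integral of `t^(θ-1) exp(-(2i+1)t)`, then sum under the integral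
sign with `hasSum_odd_exp_mul_sin`. The right-hand side depends on `x` only through `sin x` and is
monotone in it. -/
theorem hasSum_odd_rpow_mul_sin {θ : ℝ} (hθ : 0 < θ) (x : ℝ) :
    HasSum (fun i : ℕ => (2 * i + 1 : ℝ) ^ (-1 - θ) * Real.sin ((2 * i + 1) * x))
      (oddSineIntegral θ (Real.sin x)) := by
  have hk : ∀ i : ℕ, (0 : ℝ) < 2 * i + 1 := fun i => by positivity
  have hΓ := Real.Gamma_pos_of_pos hθ
  have hI : ∀ i : ℕ, IntegrableOn
      (fun t : ℝ => t ^ (θ - 1) * Real.exp (-((2 * i + 1) * t))) (Ioi 0) := fun i => by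
    refine Integrable.mono' (integrableOn_rpow_mul_exp_neg hθ)
      (by fun_prop) ((ae_restrict_iff' measurableSet_Ioi).2
        (Eventually.of_forall fun t (ht : 0 < t) => ?_))
    rw [Real.norm_of_nonneg (by positivity)]
    refine mul_le_mul_of_nonneg_left (Real.exp_le_exp.2 ?_) (by positivity)
    nlinarith [mul_nonneg (Nat.cast_nonneg (α := ℝ) i) ht.le]
  have hrpow : ∀ i : ℕ, (1 / (2 * i + 1 : ℝ)) ^ θ / (2 * i + 1) = (2 * i + 1 : ℝ) ^ (-1 - θ) :=
    fun i => by
      rw [one_div, Real.inv_rpow (hk i).le, ← Real.rpow_neg (hk i).le,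
        show -1 - θ = -θ + -1 by ring, Real.rpow_add (hk i), Real.rpow_neg_one, div_eq_mul_inv]
  have hF : ∀ i : ℕ, ∫ t in Ioi (0 : ℝ), t ^ (θ - 1) * (Real.exp (-((2 * i + 1) * t))
      * Real.sin ((2 * i + 1) * x) / (2 * i + 1))
      = (2 * i + 1 : ℝ) ^ (-1 - θ) * Real.sin ((2 * i + 1) * x) * Real.Gamma θ := fun i => by
    rw [← hrpow i]
    have h := Real.integral_rpow_mul_exp_neg_mul_Ioi hθ (hk i)
    calc _ = ∫ t in Ioi (0 : ℝ), t ^ (θ - 1) * Real.exp (-((2 * i + 1) * t))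
          * (Real.sin ((2 * i + 1) * x) / (2 * i + 1)) := by congr 1; funext t; ring
      _ = _ := by rw [integral_mul_const, h]; ring
  have hsum := hasSum_integral_of_summable_integral_norm (μ := volume.restrict (Ioi (0 : ℝ)))
    (F := fun (i : ℕ) (t : ℝ) => t ^ (θ - 1) * (Real.exp (-((2 * i + 1) * t))
      * Real.sin ((2 * i + 1) * x) / (2 * i + 1))) (fun i => by
      refine Integrable.congr ((hI i).mul_const (Real.sin ((2 * i + 1) * x) / (2 * i + 1)))
        (Eventually.of_forall fun t => ?_)
      beta_reduce
      ring) ?_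
  · simp_rw [hF] at hsum
    have h2 := hsum.div_const (Real.Gamma θ)
    simp_rw [mul_div_cancel_right₀ _ hΓ.ne'] at h2
    suffices h : oddSineIntegral θ (Real.sin x) = _ from h ▸ h2
    rw [oddSineIntegral, ← div_div, ← integral_div]
    congr 1
    refine setIntegral_congr_fun measurableSet_Ioi fun t (ht : 0 < t) => ?_
    rw [tsum_mul_left, (hasSum_odd_exp_mul_sin ht x).tsum_eq, mul_div_assoc]
  · refine ((summable_odd_rpow (by linarith : -1 - θ < -1)).mul_right
      (Real.Gamma θ)).of_nonneg_of_le (fun i => integral_nonneg fun _ => norm_nonneg _) fun i => ?_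
    rw [← hrpow i, div_mul_eq_mul_div, ← Real.integral_rpow_mul_exp_neg_mul_Ioi hθ (hk i),
      ← integral_div]
    refine setIntegral_mono_on ?_ ((hI i).div_const _) measurableSet_Ioi fun t (ht : 0 < t) => ?_
    · refine Integrable.norm ?_
      refine Integrable.congr ((hI i).mul_const (Real.sin ((2 * i + 1) * x) / (2 * i + 1)))
        (Eventually.of_forall fun t => ?_)
      beta_reduce
      ring
    · rw [norm_mul, norm_div, norm_mul, Real.norm_of_nonneg (by positivity : 0 ≤ t ^ (θ - 1)),
        Real.norm_of_nonneg (Real.exp_pos _).le, Real.norm_of_nonneg (hk i).le,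
        mul_div_assoc (t ^ (θ - 1))]
      refine mul_le_mul_of_nonneg_left (div_le_div_of_nonneg_right ?_ (hk i).le) (by positivity)
      exact mul_le_of_le_one_right (Real.exp_pos _).le (Real.abs_sin_le_one _)

/-! ### Increments of the integral in the variable `S`. -/

theorem integrableOn_rpow_mul_arctan_sub {θ S S' : ℝ} (hθ : 0 < θ) (hS : |S| ≤ 1) (hS' : |S'| ≤ 1) :
    IntegrableOn (fun t : ℝ => t ^ (θ - 1) *
      (Real.arctan (S / Real.sinh t) - Real.arctan (S' / Real.sinh t))) (Ioi 0) :=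
  ((integrableOn_rpow_mul_arctan hθ hS).sub (integrableOn_rpow_mul_arctan hθ hS')).congr
    (Eventually.of_forall fun t => by simp only [Pi.sub_apply]; ring)

theorem oddSineIntegral_sub {θ S S' : ℝ} (hθ : 0 < θ) (hS : |S| ≤ 1) (hS' : |S'| ≤ 1) :
    oddSineIntegral θ S - oddSineIntegral θ S' = (∫ t in Ioi (0 : ℝ), t ^ (θ - 1) *
      (Real.arctan (S / Real.sinh t) - Real.arctan (S' / Real.sinh t))) / (2 * Real.Gamma θ) := by
  rw [oddSineIntegral, oddSineIntegral, ← sub_div, ← integral_sub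
    (integrableOn_rpow_mul_arctan hθ hS) (integrableOn_rpow_mul_arctan hθ hS')]
  simp_rw [mul_sub]

theorem arctan_div_sinh_sub_nonneg {S S' t : ℝ} (ht : 0 < t) (h : S' ≤ S) :
    0 ≤ Real.arctan (S / Real.sinh t) - Real.arctan (S' / Real.sinh t) :=
  sub_nonneg.2 (Real.arctan_mono (div_le_div_of_nonneg_right h (Real.sinh_pos_iff.2 ht).le))

theorem arctan_sub_le_pi (a b : ℝ) : Real.arctan a - Real.arctan b ≤ Real.pi := by
  linarith [Real.arctan_lt_pi_div_two a, Real.neg_pi_div_two_lt_arctan b]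

theorem setIntegral_Ioc_rpow {p r : ℝ} (hp : 0 < p) (hr : 0 ≤ r) :
    IntegrableOn (fun t : ℝ => t ^ (p - 1)) (Ioc 0 r) ∧
      ∫ t in Ioc 0 r, t ^ (p - 1) = r ^ p / p := by
  refine ⟨(intervalIntegral.intervalIntegrable_rpow' (by linarith)).1, ?_⟩
  rw [← intervalIntegral.integral_of_le hr, integral_rpow (Or.inl (by linarith)), sub_add_cancel,
    Real.zero_rpow hp.ne', sub_zero]

/-- Cut at `r`: below it use `f ≤ M`, above it `t^(p-q) ≤ r^(p-q)`. The free parameter `r` is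
optimized later, which is the interpolation behind case (i). -/
theorem setIntegral_rpow_mul_le_add {f : ℝ → ℝ} {M p q r : ℝ} (hp : 0 < p) (hpq : p ≤ q)
    (hr : 0 < r) (hf0 : ∀ t, 0 < t → 0 ≤ f t) (hfM : ∀ t, 0 < t → f t ≤ M)
    (hip : IntegrableOn (fun t => t ^ (p - 1) * f t) (Ioi 0))
    (hiq : IntegrableOn (fun t => t ^ (q - 1) * f t) (Ioi 0)) :
    ∫ t in Ioi (0 : ℝ), t ^ (p - 1) * f t
      ≤ M * (r ^ p / p) + r ^ (p - q) * ∫ t in Ioi (0 : ℝ), t ^ (q - 1) * f t := by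
  obtain ⟨hir, hir'⟩ := setIntegral_Ioc_rpow hp hr.le
  have hM : 0 ≤ M := (hf0 1 one_pos).trans (hfM 1 one_pos)
  rw [← Ioc_union_Ioi_eq_Ioi hr.le, setIntegral_union (Ioc_disjoint_Ioi le_rfl) measurableSet_Ioi
    (hip.mono_set Ioc_subset_Ioi_self) (hip.mono_set (Ioi_subset_Ioi hr.le))]
  refine add_le_add ?_ ?_
  · rw [← hir', ← integral_const_mul]
    refine setIntegral_mono_on (hip.mono_set Ioc_subset_Ioi_self) (hir.const_mul M)
      measurableSet_Ioc fun t ht => ?_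
    rw [mul_comm]
    exact mul_le_mul_of_nonneg_right (hfM t ht.1) (Real.rpow_nonneg ht.1.le _)
  · rw [Ioc_union_Ioi_eq_Ioi hr.le, ← integral_const_mul]
    refine (setIntegral_mono_on (hip.mono_set (Ioi_subset_Ioi hr.le))
      ((hiq.mono_set (Ioi_subset_Ioi hr.le)).const_mul _) measurableSet_Ioi fun t ht => ?_).trans
      (setIntegral_mono_set (hiq.const_mul _) ?_ (Ioi_subset_Ioi hr.le).eventuallyLE)
    · have ht0 : 0 < t := hr.trans ht
      rw [← mul_assoc]
      refine mul_le_mul_of_nonneg_right ?_ (hf0 t ht0)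
      rw [show p - 1 = (p - q) + (q - 1) by ring, Real.rpow_add ht0]
      exact mul_le_mul_of_nonneg_right
        (Real.rpow_le_rpow_of_nonpos hr (mem_Ioi.1 ht).le (by linarith)) (by positivity)
    · refine (ae_restrict_iff' measurableSet_Ioi).2 (Eventually.of_forall fun t (ht : 0 < t) => ?_)
      have := hf0 t ht
      positivity

/-- Cut at `t = d`, using `M` below and `d / t` above; the tail converges because `p < 1`. -/
theorem setIntegral_rpow_mul_le_rpow {f : ℝ → ℝ} {M p d : ℝ} (hp : 0 < p) (hp1 : p < 1)
    (hd : 0 < d) (hfM : ∀ t, 0 < t → f t ≤ M) (hfd : ∀ t, 0 < t → f t ≤ d / t)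
    (hip : IntegrableOn (fun t => t ^ (p - 1) * f t) (Ioi 0)) :
    ∫ t in Ioi (0 : ℝ), t ^ (p - 1) * f t ≤ (M / p + 1 / (1 - p)) * d ^ p := by
  obtain ⟨hir, hir'⟩ := setIntegral_Ioc_rpow hp hd.le
  rw [← Ioc_union_Ioi_eq_Ioi hd.le, setIntegral_union (Ioc_disjoint_Ioi le_rfl) measurableSet_Ioi
    (hip.mono_set Ioc_subset_Ioi_self) (hip.mono_set (Ioi_subset_Ioi hd.le)), add_mul]
  refine add_le_add ?_ ?_
  · rw [div_mul_eq_mul_div, mul_div_assoc, ← hir', ← integral_const_mul]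
    refine setIntegral_mono_on (hip.mono_set Ioc_subset_Ioi_self) (hir.const_mul M)
      measurableSet_Ioc fun t ht => ?_
    rw [mul_comm]
    exact mul_le_mul_of_nonneg_right (hfM t ht.1) (Real.rpow_nonneg ht.1.le _)
  · have h2 : p - 2 < -1 := by linarith
    have hval : 1 / (1 - p) * d ^ p = ∫ t in Ioi d, d * t ^ (p - 2) := by
      rw [integral_const_mul, integral_Ioi_rpow_of_lt h2 hd, show p - 2 + 1 = p - 1 by ring,
        Real.rpow_sub_one hd.ne', show p - 1 = -(1 - p) by ring]
      have : 1 - p ≠ 0 := by linarith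
      field_simp
    rw [hval]
    refine setIntegral_mono_on (hip.mono_set (Ioi_subset_Ioi hd.le))
      ((integrableOn_Ioi_rpow_of_lt h2 hd).const_mul d) measurableSet_Ioi fun t ht => ?_
    have ht0 : 0 < t := hd.trans ht
    refine (mul_le_mul_of_nonneg_left (hfd t ht0) (by positivity)).trans (le_of_eq ?_)
    rw [show p - 2 = p - 1 - 1 by ring, Real.rpow_sub_one ht0.ne' (p - 1)]
    field_simp

/-- Continuity of the Gamma function on a compact interval. One constant for all `p` is needed
because the exponents vary with the layer `j`. -/
theorem exists_Gamma_add_div_Gamma_le {a b : ℝ} (ha : 0 < a) {σ : ℝ} (hσ : 0 ≤ σ) :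
    ∃ K, 0 ≤ K ∧ ∀ p ∈ Icc a b, 1 / Real.Gamma p ≤ K ∧
      Real.Gamma (p + σ) / Real.Gamma p ≤ K := by
  have hc : ∀ τ, 0 ≤ τ → ContinuousOn (fun p => Real.Gamma (p + τ)) (Icc a b) := fun τ hτ p hp =>
    have hpos : 0 < p + τ := by linarith [hp.1]
    ContinuousAt.continuousWithinAt (ContinuousAt.comp (f := fun p => p + τ)
      (Real.differentiableAt_Gamma fun m => by
        have : (0 : ℝ) ≤ m := Nat.cast_nonneg m
        linarith).continuousAt (by fun_prop))
  have hne : ∀ p ∈ Icc a b, Real.Gamma p ≠ 0 := fun p hp =>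
    (Real.Gamma_pos_of_pos (ha.trans_le hp.1)).ne'
  have hc0 : ContinuousOn Real.Gamma (Icc a b) := by simpa using hc 0 le_rfl
  obtain ⟨K₁, h₁⟩ := isCompact_Icc.exists_bound_of_continuousOn (continuousOn_const.div hc0 hne
    (f := fun _ => (1 : ℝ)))
  obtain ⟨K₂, h₂⟩ := isCompact_Icc.exists_bound_of_continuousOn ((hc σ hσ).div hc0 hne)
  refine ⟨max 0 (max K₁ K₂), le_max_left _ _, fun p hp => ⟨?_, ?_⟩⟩
  · exact (le_abs_self _).trans ((h₁ p hp).trans (by simp))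
  · exact (le_abs_self _).trans ((h₂ p hp).trans (by simp))

theorem oddSineIntegral_sub_le_add {a b σ : ℝ} (ha : 0 < a) (hσ : 0 ≤ σ) :
    ∃ K, 0 ≤ K ∧ ∀ p ∈ Icc a b, ∀ r, 0 < r → ∀ S ∈ Icc (-1 : ℝ) 1, ∀ S' ∈ Icc (-1 : ℝ) 1, S' ≤ S →
      oddSineIntegral p S - oddSineIntegral p S'
        ≤ K * (r ^ p + r ^ (-σ) * (oddSineIntegral (p + σ) S - oddSineIntegral (p + σ) S')) := by
  obtain ⟨K, hK0, hK⟩ := exists_Gamma_add_div_Gamma_le (b := b) ha hσ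
  refine ⟨K * (1 + Real.pi / a), by positivity, fun p hp r hr S hS S' hS' hle => ?_⟩
  have hp0 : 0 < p := ha.trans_le hp.1
  have hq0 : 0 < p + σ := by linarith
  have hΓp := Real.Gamma_pos_of_pos hp0
  have hΓq := Real.Gamma_pos_of_pos hq0
  obtain ⟨hK1, hK2⟩ := hK p hp
  have hS := abs_le.2 hS
  have hS' := abs_le.2 hS'
  rw [oddSineIntegral_sub hp0 hS hS', oddSineIntegral_sub hq0 hS hS']
  have h := setIntegral_rpow_mul_le_add hp0 (by linarith : p ≤ p + σ) hr
    (fun t ht => arctan_div_sinh_sub_nonneg ht hle) (fun t _ => arctan_sub_le_pi _ _)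
    (integrableOn_rpow_mul_arctan_sub hp0 hS hS') (integrableOn_rpow_mul_arctan_sub hq0 hS hS')
  have hJ : 0 ≤ ∫ t in Ioi (0 : ℝ), t ^ (p + σ - 1) *
      (Real.arctan (S / Real.sinh t) - Real.arctan (S' / Real.sinh t)) :=
    setIntegral_nonneg measurableSet_Ioi fun t (ht : 0 < t) =>
      mul_nonneg (by positivity) (arctan_div_sinh_sub_nonneg ht hle)
  set J := ∫ t in Ioi (0 : ℝ), t ^ (p + σ - 1) *
      (Real.arctan (S / Real.sinh t) - Real.arctan (S' / Real.sinh t))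
  rw [show p - (p + σ) = -σ by ring] at h
  have hA : 0 ≤ r ^ p := by positivity
  have hB : 0 ≤ r ^ (-σ) * (J / (2 * Real.Gamma (p + σ))) := by positivity
  have hpa : 0 ≤ Real.pi / a := by positivity
  have e1 : Real.pi * (r ^ p / p) / (2 * Real.Gamma p) ≤ K * (Real.pi / a) * r ^ p := by
    have : Real.pi / p ≤ Real.pi / a := div_le_div_of_nonneg_left Real.pi_pos.le ha hp.1
    calc Real.pi * (r ^ p / p) / (2 * Real.Gamma p)
        = (1 / 2) * (1 / Real.Gamma p * (Real.pi / p) * r ^ p) := by field_simp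
      _ ≤ 1 * (1 / Real.Gamma p * (Real.pi / p) * r ^ p) :=
          mul_le_mul_of_nonneg_right (by norm_num) (by positivity)
      _ ≤ K * (Real.pi / a) * r ^ p := by
          rw [one_mul]; gcongr
  have e2 : r ^ (-σ) * J / (2 * Real.Gamma p)
      ≤ K * (r ^ (-σ) * (J / (2 * Real.Gamma (p + σ)))) := by
    calc r ^ (-σ) * J / (2 * Real.Gamma p) = Real.Gamma (p + σ) / Real.Gamma p *
          (r ^ (-σ) * (J / (2 * Real.Gamma (p + σ)))) := by field_simp
      _ ≤ _ := mul_le_mul_of_nonneg_right hK2 hB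
  refine (div_le_div_of_nonneg_right h (by positivity)).trans ?_
  rw [add_div]
  refine (add_le_add e1 e2).trans ?_
  nlinarith [mul_nonneg hK0 hA, mul_nonneg (mul_nonneg hK0 hpa) hB]

theorem oddSineIntegral_sub_le_rpow {a b : ℝ} (ha : 0 < a) (hb : b < 1) :
    ∃ K, 0 ≤ K ∧ ∀ p ∈ Icc a b, ∀ S ∈ Icc (-1 : ℝ) 1, ∀ S' ∈ Icc (-1 : ℝ) 1, S' ≤ S →
      oddSineIntegral p S - oddSineIntegral p S' ≤ K * (S - S') ^ p := by
  obtain ⟨K, hK0, hK⟩ := exists_Gamma_add_div_Gamma_le (b := b) ha le_rfl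
  have hb' : 0 < 1 - b := by linarith
  refine ⟨K * (Real.pi / a + 1 / (1 - b)), by positivity, fun p hp S hS S' hS' hle => ?_⟩
  have hp0 : 0 < p := ha.trans_le hp.1
  have hp1 : p < 1 := hp.2.trans_lt hb
  have hp1' : 0 < 1 - p := by linarith
  have hΓp := Real.Gamma_pos_of_pos hp0
  rcases hle.eq_or_lt with rfl | hlt
  · simp [hp0.ne']
  have hS := abs_le.2 hS
  have hS' := abs_le.2 hS'
  have hd : 0 < S - S' := sub_pos.2 hlt
  rw [oddSineIntegral_sub hp0 hS hS']
  have h := setIntegral_rpow_mul_le_rpow hp0 hp1 hd (fun t _ => arctan_sub_le_pi _ _)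
    (fun t ht => (le_abs_self _).trans ((abs_arctan_sub_le (S / Real.sinh t) (S' / Real.sinh t)).trans
      (by
        have hs := Real.sinh_pos_iff.2 ht
        rw [← sub_div, abs_of_nonneg (by positivity)]
        exact div_le_div_of_nonneg_left hd.le ht (Real.self_le_sinh_iff.2 ht.le))))
    (integrableOn_rpow_mul_arctan_sub hp0 hS hS')
  refine (div_le_div_of_nonneg_right h (by positivity)).trans ?_
  calc (Real.pi / p + 1 / (1 - p)) * (S - S') ^ p / (2 * Real.Gamma p)
      = (1 / 2) * (1 / Real.Gamma p * (Real.pi / p + 1 / (1 - p)) * (S - S') ^ p) := by field_simp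
    _ ≤ 1 * (1 / Real.Gamma p * (Real.pi / p + 1 / (1 - p)) * (S - S') ^ p) :=
        mul_le_mul_of_nonneg_right (by norm_num) (by positivity)
    _ ≤ K * (Real.pi / a + 1 / (1 - b)) * (S - S') ^ p := by
        rw [one_mul]
        have h1 := (hK p hp).1
        have h2 := hp.1
        have h3 := hp.2
        gcongr

theorem oddSineIntegral_mono {q S S' : ℝ} (hq : 0 < q) (hS : S ∈ Icc (-1 : ℝ) 1)
    (hS' : S' ∈ Icc (-1 : ℝ) 1) (hle : S' ≤ S) : oddSineIntegral q S' ≤ oddSineIntegral q S := by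
  rw [← sub_nonneg, oddSineIntegral_sub hq (abs_le.2 hS) (abs_le.2 hS')]
  refine div_nonneg (setIntegral_nonneg measurableSet_Ioi fun t (ht : 0 < t) =>
      mul_nonneg (by positivity) (arctan_div_sinh_sub_nonneg ht hle)) ?_
  have := Real.Gamma_pos_of_pos hq
  positivity

/-- Only `1 < t ≤ 2` is kept: there the arguments of the arctangent stay in a fixed compact
interval, where its derivative is bounded below, and `t^(q-1) ≥ 1/t ≥ 1/2`. -/
theorem exists_mul_le_oddSineIntegral_sub {q : ℝ} (hq : 0 < q) :
    ∃ c, 0 < c ∧ ∀ S ∈ Icc (-1 : ℝ) 1, ∀ S' ∈ Icc (-1 : ℝ) 1, S' ≤ S →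
      c * (S - S') ≤ oddSineIntegral q S - oddSineIntegral q S' := by
  have hΓ := Real.Gamma_pos_of_pos hq
  have hs1 : 0 < Real.sinh 1 := Real.sinh_pos_iff.2 one_pos
  have hs2 : 0 < Real.sinh 2 := Real.sinh_pos_iff.2 two_pos
  set M := 1 / Real.sinh 1 with hM
  have hM0 : 0 < M := by positivity
  refine ⟨1 / 2 * (1 / Real.sinh 2 / (1 + M ^ 2)) / (2 * Real.Gamma q), by positivity,
    fun S hS S' hS' hle => ?_⟩
  rw [oddSineIntegral_sub hq (abs_le.2 hS) (abs_le.2 hS'), div_mul_eq_mul_div]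
  refine div_le_div_of_nonneg_right ?_ (by positivity)
  have hint := integrableOn_rpow_mul_arctan_sub hq (abs_le.2 hS) (abs_le.2 hS')
  have hsub : Ioc (1 : ℝ) 2 ⊆ Ioi 0 := fun t ht => one_pos.trans ht.1
  refine le_trans ?_ (setIntegral_mono_set hint ?_ hsub.eventuallyLE)
  · have hconst : 1 / 2 * (1 / Real.sinh 2 / (1 + M ^ 2)) * (S - S')
        = ∫ _ in Ioc (1 : ℝ) 2, 1 / 2 * (1 / Real.sinh 2 / (1 + M ^ 2)) * (S - S') := by
      simp; norm_num
    rw [hconst]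
    refine setIntegral_mono_on (integrableOn_const (by simp)) (hint.mono_set hsub) measurableSet_Ioc fun t ht => ?_
    have ht0 : 0 < t := hsub ht
    have hs : 0 < Real.sinh t := Real.sinh_pos_iff.2 ht0
    have hsle : Real.sinh 1 ≤ Real.sinh t := Real.sinh_le_sinh.2 ht.1.le
    have hsle2 : Real.sinh t ≤ Real.sinh 2 := Real.sinh_le_sinh.2 ht.2
    have hmem : ∀ R ∈ Icc (-1 : ℝ) 1, R / Real.sinh t ∈ Icc (-M) M := fun R hR => by
      rw [mem_Icc, ← abs_le, abs_div, abs_of_pos hs]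
      exact div_le_div₀ zero_le_one (abs_le.2 hR) hs1 hsle
    have h1 := div_le_arctan_sub (hmem S hS) (hmem S' hS') (div_le_div_of_nonneg_right hle hs.le)
    have h2 : 1 / 2 ≤ t ^ (q - 1) := by
      have h3 : t ^ (-1 : ℝ) ≤ t ^ (q - 1) :=
        Real.rpow_le_rpow_of_exponent_le ht.1.le (by linarith)
      refine le_trans ?_ h3
      rw [Real.rpow_neg_one, one_div]
      exact inv_anti₀ ht0 ht.2
    rw [mul_assoc]
    refine mul_le_mul h2 (le_trans ?_ h1) ?_ (by positivity)
    · rw [div_mul_eq_mul_div, ← sub_div, one_div_mul_eq_div]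
      have : 0 ≤ S - S' := sub_nonneg.2 hle
      gcongr
    · have : 0 ≤ S - S' := sub_nonneg.2 hle
      positivity
  · exact (ae_restrict_iff' measurableSet_Ioi).2 (Eventually.of_forall fun t (ht : 0 < t) =>
      mul_nonneg (by positivity) (arctan_div_sinh_sub_nonneg ht hle))

theorem sinh_le_two_mul {t : ℝ} (h0 : 0 ≤ t) (h1 : t ≤ 1) : Real.sinh t ≤ 2 * t := by
  have h2 := (abs_le.1 (Real.abs_exp_sub_one_sub_id_le (abs_le.2 ⟨by linarith, h1⟩))).2
  have h3 := Real.add_one_le_exp (-t)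
  rw [Real.sinh_eq]
  nlinarith

/-- For `0 < t ≤ x ≤ 1`, `sin x ≥ x/2` and `sinh t ≤ 2t ≤ 2x`, so the arctangent is at least `arctan
(1/4)`; the rest of the integral is nonnegative. -/
theorem exists_mul_rpow_le_oddSineIntegral {θ : ℝ} (hθ : 0 < θ) :
    ∃ c, 0 < c ∧ ∀ x, 0 ≤ x → x ≤ 1 → c * x ^ θ ≤ oddSineIntegral θ (Real.sin x) := by
  have hΓ := Real.Gamma_pos_of_pos hθ
  have hA : 0 < Real.arctan (1 / 4) := Real.arctan_pos.2 (by norm_num)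
  refine ⟨Real.arctan (1 / 4) / θ / (2 * Real.Gamma θ), by positivity, fun x hx0 hx1 => ?_⟩
  rw [oddSineIntegral, div_mul_eq_mul_div]
  refine div_le_div_of_nonneg_right ?_ (by positivity)
  have hint := integrableOn_rpow_mul_arctan hθ (Real.abs_sin_le_one x)
  have hsin0 : 0 ≤ Real.sin x :=
    Real.sin_nonneg_of_nonneg_of_le_pi hx0 (by linarith [Real.pi_gt_three])
  have hsin : x / 2 ≤ Real.sin x := by
    rcases hx0.eq_or_lt with rfl | hx
    · simp
    · have := Real.sin_gt_sub_cube hx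
      nlinarith [pow_pos hx 3, mul_nonneg hx0 (sub_nonneg.2 hx1), pow_le_one₀ hx0 hx1 (n := 2)]
  obtain ⟨hir, hir'⟩ := setIntegral_Ioc_rpow hθ hx0
  have hsub : Ioc 0 x ⊆ Ioi 0 := Ioc_subset_Ioi_self
  refine le_trans ?_ (setIntegral_mono_set hint ?_ hsub.eventuallyLE)
  · rw [div_mul_eq_mul_div, mul_div_assoc, ← hir', ← integral_const_mul]
    refine setIntegral_mono_on (hir.const_mul _) (hint.mono_set Ioc_subset_Ioi_self)
      measurableSet_Ioc fun t ht => ?_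
    rw [mul_comm]
    refine mul_le_mul_of_nonneg_left (Real.arctan_mono ?_) (Real.rpow_nonneg ht.1.le _)
    rw [le_div_iff₀ (Real.sinh_pos_iff.2 ht.1)]
    linarith [sinh_le_two_mul ht.1.le (ht.2.trans hx1), ht.2]
  · refine (ae_restrict_iff' measurableSet_Ioi).2 (Eventually.of_forall fun t (ht : 0 < t) =>
      mul_nonneg (by positivity) (Real.arctan_nonneg.2 ?_))
    exact div_nonneg hsin0 (Real.sinh_pos_iff.2 ht).le

/-! ### Extension of a Hölder function from the range of `u`. -/

/-- Hölder extension: a bounded function `g` that is Hölder in terms of `u` is a Hölder function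
of `u`. -/
theorem exists_isHolder_comp_eq {X : Type*} [Nonempty X] {u g : X → ℝ} {β C M : ℝ} (hβ0 : 0 < β)
    (hβ1 : β < 1) (hC : 0 ≤ C) (hM : ∀ x, |g x| ≤ M)
    (h : ∀ x y, |g x - g y| ≤ C * |u x - u y| ^ β) :
    ∃ f : ℝ → ℝ, IsHolder β univ f ∧ ∀ x, f (u x) = g x := by
  have hnn : ∀ t y, 0 ≤ C * |t - u y| ^ β := fun t y => by positivity
  have hbdd : ∀ t, BddBelow (range fun y => g y + C * |t - u y| ^ β) := fun t => ⟨-M, by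
    rintro _ ⟨y, rfl⟩
    linarith [hnn t y, (abs_le.1 (hM y)).1]⟩
  -- McShane's formula; it works for the power `β ≤ 1` because `r ↦ r^β` is subadditive.
  set e : ℝ → ℝ := fun t => ⨅ y, g y + C * |t - u y| ^ β with he
  have he_sub : ∀ t t', e t - e t' ≤ C * |t - t'| ^ β := fun t t' => by
    rw [sub_le_comm]
    refine le_ciInf fun y => ?_
    have h1 : e t ≤ g y + C * |t - u y| ^ β := ciInf_le (hbdd t) y
    have h2 : |t - u y| ^ β ≤ |t - t'| ^ β + |t' - u y| ^ β :=
      (Real.rpow_le_rpow (abs_nonneg _) (abs_sub_le _ _ _) hβ0.le).trans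
        (Real.rpow_add_le_add_rpow (abs_nonneg _) (abs_nonneg _) hβ0.le hβ1.le)
    nlinarith [mul_le_mul_of_nonneg_left h2 hC]
  have he_abs : ∀ t t', |e t - e t'| ≤ C * |t - t'| ^ β := fun t t' =>
    abs_sub_le_iff.2 ⟨he_sub t t', by rw [abs_sub_comm]; exact he_sub t' t⟩
  have hM0 : 0 ≤ M := (abs_nonneg _).trans (hM (Classical.arbitrary X))
  have hfl : ⌊β⌋₊ = 0 := Nat.floor_eq_zero.2 hβ1
  -- The infimum is bounded below by `-M` but may grow at infinity; truncating at `M` makes it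
  -- bounded without changing it on the range of `u`.
  have hf : HolderOnWith C.toNNReal β.toNNReal (fun t => min M (e t)) univ :=
    holderOnWith_of_abs_sub_le hβ0.le fun t _ t' _ =>
      (abs_min_sub_min_le_max M (e t) M (e t')).trans (by simpa using he_abs t t')
  refine ⟨fun t => min M (e t), ⟨?_, ?_, ?_⟩, fun x => ?_⟩
  · rw [hfl]
    exact contDiffOn_zero.2 (hf.continuousOn (by simpa using hβ0))
  · intro k hk
    obtain rfl : k = 0 := by omega
    refine ⟨M, fun t _ => ?_⟩
    rw [iteratedDerivWithin_zero]
    refine abs_le.2 ⟨le_min (by linarith) (le_ciInf fun y => ?_), min_le_left _ _⟩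
    linarith [hnn t y, (abs_le.1 (hM y)).1]
  · rw [hfl, iteratedDerivWithin_zero]
    exact ⟨_, by simpa using hf⟩
  · have h1 : e (u x) ≤ g x := by
      refine (ciInf_le (hbdd (u x)) x).trans ?_
      simp [hβ0.ne']
    have h2 : g x ≤ e (u x) := le_ciInf fun y => by
      linarith [(abs_le.1 (h x y)).2]
    beta_reduce
    rw [le_antisymm h1 h2]
    exact min_eq_right (abs_le.1 (hM x)).2

/-! ### Superposition of series with exponents approaching the critical one. -/

section Superposition

/-- The exponents `h / (j + 1)`, which decrease to `0`. -/
noncomputable def excess (h : ℝ) (j : ℕ) : ℝ := h / (j + 1)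

theorem excess_pos {h : ℝ} (hh : 0 < h) (j : ℕ) : 0 < excess h j := div_pos hh (by positivity)

theorem excess_le {h : ℝ} (hh : 0 < h) (j : ℕ) : excess h j ≤ h :=
  div_le_self hh.le (by linarith [Nat.cast_nonneg (α := ℝ) j])

theorem exists_excess_lt (h : ℝ) {δ : ℝ} (hδ : 0 < δ) : ∃ j, excess h j < δ := by
  have : Tendsto (fun j : ℕ => h / ((j : ℝ) + 1)) atTop (𝓝 0) := by
    simpa [div_eq_mul_inv] using
      (tendsto_one_div_add_atTop_nhds_zero_nat (𝕜 := ℝ)).const_mul h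
  exact (this.eventually (eventually_lt_nhds hδ)).exists

/-- Positive weights that make `∑ weight h j * (2 i + 1) ^ (-1 - excess h j)` converge. -/
noncomputable def weight (h : ℝ) (j : ℕ) : ℝ :=
  (1 / 2) ^ j / (1 + ∑' i : ℕ, (2 * i + 1 : ℝ) ^ (-1 - excess h j))

theorem tsum_odd_rpow_nonneg (p : ℝ) : 0 ≤ ∑' i : ℕ, (2 * i + 1 : ℝ) ^ p :=
  tsum_nonneg fun i => by positivity

theorem weight_pos (h : ℝ) (j : ℕ) : 0 < weight h j := by
  have := tsum_odd_rpow_nonneg (-1 - excess h j)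
  unfold weight
  positivity

/-- The normalization in `weight` makes the sum over layer `j` at most `2^(-j)`. -/
theorem summable_weight_mul {h : ℝ} (hh : 0 < h) :
    Summable fun q : ℕ × ℕ => weight h q.1 * (2 * q.2 + 1 : ℝ) ^ (-1 - excess h q.1) := by
  refine (summable_prod_of_nonneg fun q => ?_).2 ⟨fun j => ?_, ?_⟩
  · have := weight_pos h q.1
    positivity
  · exact (summable_odd_rpow (by linarith [excess_pos hh j] : -1 - excess h j < -1)).mul_left (weight h j)
  · refine summable_geometric_two.of_nonneg_of_le (fun j => tsum_nonneg fun i => ?_) fun j => ?_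
    · have := weight_pos h j
      positivity
    · simp only
      have := tsum_odd_rpow_nonneg (-1 - excess h j)
      rw [tsum_mul_left, weight, div_mul_eq_mul_div, div_le_iff₀ (by linarith)]
      exact mul_le_mul_of_nonneg_left (by linarith) (by positivity)

/-- The coefficients of the superposition of the series `∑ (2 i + 1) ^ (-1 - θ - excess h j)`. -/
noncomputable def oddCoeff (h θ : ℝ) (q : ℕ × ℕ) : ℝ :=
  weight h q.1 * (2 * q.2 + 1 : ℝ) ^ (-1 - θ - excess h q.1)

theorem oddCoeff_nonneg (h θ : ℝ) (q : ℕ × ℕ) : 0 ≤ oddCoeff h θ q :=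
  mul_nonneg (weight_pos h q.1).le (by positivity)

theorem summable_oddCoeff {h θ : ℝ} (hh : 0 < h) (hθ : 0 ≤ θ) : Summable (oddCoeff h θ) := by
  refine (summable_weight_mul hh).of_nonneg_of_le (oddCoeff_nonneg h θ) fun q =>
    mul_le_mul_of_nonneg_left (Real.rpow_le_rpow_of_exponent_le ?_ (by linarith))
      (weight_pos h q.1).le
  linarith [Nat.cast_nonneg (α := ℝ) q.2]

/-- The family is stable under powers of the frequency, so derivatives and the fractional Laplacian
only shift the parameter `θ`. -/
theorem oddCoeff_mul_rpow (h θ σ : ℝ) (q : ℕ × ℕ) :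
    oddCoeff h θ q * (2 * q.2 + 1 : ℝ) ^ σ = oddCoeff h (θ - σ) q := by
  have hk : (0 : ℝ) < 2 * q.2 + 1 := by positivity
  rw [oddCoeff, oddCoeff, mul_assoc, ← Real.rpow_add hk]
  congr 2
  ring

/-- The frequencies `ω (2 i + 1)`. -/
noncomputable def oddFreq (ω : ℝ) (q : ℕ × ℕ) : ℝ := ω * (2 * q.2 + 1)

theorem oddFreq_pos {ω : ℝ} (hω : 0 < ω) (q : ℕ × ℕ) : 0 < oddFreq ω q :=
  mul_pos hω (by positivity)

theorem oddCoeff_mul_oddFreq_rpow {ω : ℝ} (hω : 0 < ω) (h θ σ : ℝ) (q : ℕ × ℕ) :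
    oddCoeff h θ q * oddFreq ω q ^ σ = ω ^ σ * oddCoeff h (θ - σ) q := by
  rw [oddFreq, Real.mul_rpow hω.le (by positivity), ← oddCoeff_mul_rpow]
  ring

theorem oddCoeff_mul_oddFreq_pow {ω : ℝ} (hω : 0 < ω) (h θ : ℝ) (n : ℕ) (q : ℕ × ℕ) :
    oddCoeff h θ q * oddFreq ω q ^ n = ω ^ n * oddCoeff h (θ - n) q := by
  rw [← Real.rpow_natCast, oddCoeff_mul_oddFreq_rpow hω, Real.rpow_natCast]

theorem summable_oddCoeff_mul_oddFreq_pow {ω : ℝ} (hω : 0 < ω) {h θ : ℝ} (hh : 0 < h) {n : ℕ}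
    (hn : n ≤ θ) : Summable fun q => oddCoeff h θ q * oddFreq ω q ^ n := by
  simp_rw [oddCoeff_mul_oddFreq_pow hω]
  exact (summable_oddCoeff hh (sub_nonneg.2 hn)).mul_left _

/-- With `θ` the fractional part of `γ`, `min 2 y ≤ 2 y^θ` reduces the Hölder bound to summability
of `oddCoeff h 0`, the borderline case that holds because every excess is positive. -/
theorem isHolder_oddSeries {ω : ℝ} (hω : 0 < ω) {h γ : ℝ} (hh : 0 < h) (hγ : 0 ≤ γ) :
    IsHolder γ univ (trigSeries (oddCoeff h γ) (oddFreq ω) 0) := by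
  have hfl : (⌊γ⌋₊ : ℝ) ≤ γ := Nat.floor_le hγ
  refine isHolder_trigSeries (oddCoeff_nonneg h γ) (fun q => (oddFreq_pos hω q).le) hγ
    (fun n hn => summable_oddCoeff_mul_oddFreq_pow hω hh
      ((Nat.cast_le.2 hn).trans hfl)) fun hθ => ?_
  set θ := γ - ⌊γ⌋₊ with hθdef
  have hθ1 : θ ≤ 1 := by linarith [Nat.lt_floor_add_one γ]
  have hmin : ∀ y : ℝ, 0 ≤ y → min 2 y ≤ 2 * y ^ θ := fun y hy => by
    rcases le_total y 1 with h1 | h1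
    · have h2 := Real.rpow_le_rpow_of_exponent_ge_of_imp hy h1 hθ1 fun _ => by
        intro h3; linarith
      rw [Real.rpow_one] at h2
      linarith [min_le_right 2 y]
    · linarith [min_le_left 2 y, Real.one_le_rpow h1 hθ.le]
  have hsum := (summable_oddCoeff hh (le_refl 0)).mul_left (ω ^ ⌊γ⌋₊ * 2 * ω ^ θ)
  refine ⟨∑' q, ω ^ ⌊γ⌋₊ * 2 * ω ^ θ * oddCoeff h 0 q, fun y hy => ?_⟩
  have hle : ∀ q, oddCoeff h γ q * oddFreq ω q ^ ⌊γ⌋₊ * min 2 (oddFreq ω q * y)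
      ≤ ω ^ ⌊γ⌋₊ * 2 * ω ^ θ * oddCoeff h 0 q * y ^ θ := fun q => by
    have hk := (oddFreq_pos hω q).le
    have h0 := oddCoeff_nonneg h γ q
    refine (mul_le_mul_of_nonneg_left (hmin _ (mul_nonneg hk hy))
      (mul_nonneg h0 (pow_nonneg hk _))).trans (le_of_eq ?_)
    rw [Real.mul_rpow hk hy, oddCoeff_mul_oddFreq_pow hω, ← hθdef]
    have := oddCoeff_mul_oddFreq_rpow hω h θ θ q
    rw [sub_self] at this
    linear_combination (2 * ω ^ ⌊γ⌋₊ * y ^ θ) * this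
  rw [← tsum_mul_right]
  refine Summable.tsum_le_tsum hle ((hsum.mul_right (y ^ θ)).of_nonneg_of_le (fun q => ?_) hle)
    (hsum.mul_right _)
  have hk := (oddFreq_pos hω q).le
  have h0 := oddCoeff_nonneg h γ q
  have : 0 ≤ min 2 (oddFreq ω q * y) := le_min zero_le_two (mul_nonneg hk hy)
  positivity

/-- The superposition of the integrals `oddSineIntegral (θ + excess h j)`. -/
noncomputable def oddSineSum (h θ S : ℝ) : ℝ :=
  ∑' j, weight h j * oddSineIntegral (θ + excess h j) S

theorem hasSum_oddCoeff_mul_sin {h θ : ℝ} (hh : 0 < h) (hθ : 0 ≤ θ) (x : ℝ) :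
    HasSum (fun j => weight h j * oddSineIntegral (θ + excess h j) (Real.sin x))
      (∑' q : ℕ × ℕ, oddCoeff h θ q * Real.sin ((2 * q.2 + 1) * x)) := by
  have hs : Summable fun q : ℕ × ℕ => oddCoeff h θ q * Real.sin ((2 * q.2 + 1) * x) :=
    (summable_oddCoeff hh hθ).of_norm_bounded fun q => by
      rw [norm_mul, Real.norm_of_nonneg (oddCoeff_nonneg h θ q)]
      exact mul_le_of_le_one_right (oddCoeff_nonneg h θ q) (Real.abs_sin_le_one _)
  refine hs.hasSum.prod_fiberwise fun j => ?_
  have h1 := (hasSum_odd_rpow_mul_sin (by linarith [excess_pos hh j] : 0 < θ + excess h j)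
    x).mul_left (weight h j)
  refine h1.congr_fun fun i => ?_
  rw [oddCoeff, mul_assoc]
  congr 3
  ring

theorem tsum_oddCoeff_mul_sin {h θ : ℝ} (hh : 0 < h) (hθ : 0 ≤ θ) (x : ℝ) :
    ∑' q : ℕ × ℕ, oddCoeff h θ q * Real.sin ((2 * q.2 + 1) * x) = oddSineSum h θ (Real.sin x) :=
  (hasSum_oddCoeff_mul_sin hh hθ x).tsum_eq.symm

theorem summable_weight_mul_oddSineIntegral {h θ S : ℝ} (hh : 0 < h) (hθ : 0 ≤ θ)
    (hS : S ∈ Icc (-1 : ℝ) 1) :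
    Summable fun j => weight h j * oddSineIntegral (θ + excess h j) S := by
  rw [← Real.sin_arcsin hS.1 hS.2]
  exact (hasSum_oddCoeff_mul_sin hh hθ _).summable

theorem abs_oddSineSum_le {h θ S : ℝ} (hh : 0 < h) (hθ : 0 ≤ θ) (hS : S ∈ Icc (-1 : ℝ) 1) :
    |oddSineSum h θ S| ≤ ∑' q, oddCoeff h θ q := by
  rw [← Real.sin_arcsin hS.1 hS.2, ← tsum_oddCoeff_mul_sin hh hθ]
  refine tsum_of_norm_bounded (f := fun q : ℕ × ℕ => oddCoeff h θ q *
    Real.sin ((2 * q.2 + 1) * Real.arcsin S)) (summable_oddCoeff hh hθ).hasSum fun q => ?_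
  rw [norm_mul, Real.norm_of_nonneg (oddCoeff_nonneg h θ q)]
  exact mul_le_of_le_one_right (oddCoeff_nonneg h θ q) (Real.abs_sin_le_one _)

end Superposition

/-! ### Comparison of the sums for the solution and for its fractional Laplacian. -/

theorem summable_weight (h : ℝ) : Summable (weight h) := by
  refine summable_geometric_two.of_nonneg_of_le (fun j => (weight_pos h j).le) fun j => ?_
  exact div_le_self (by positivity) (by linarith [tsum_odd_rpow_nonneg (-1 - excess h j)])

theorem rpow_le_one_add {x p : ℝ} (hx : 0 ≤ x) (hp0 : 0 ≤ p) (hp1 : p ≤ 1) : x ^ p ≤ 1 + x :=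
  (Real.rpow_le_rpow hx (by linarith : x ≤ 1 + x) hp0).trans
    (by simpa using Real.rpow_le_rpow_of_exponent_le (by linarith : 1 ≤ 1 + x) hp1)

section Comparison

variable {h θ S S' : ℝ}

theorem hasSum_oddSineSum_sub (hh : 0 < h) (hθ : 0 ≤ θ) (hS : S ∈ Icc (-1 : ℝ) 1)
    (hS' : S' ∈ Icc (-1 : ℝ) 1) :
    HasSum (fun j => weight h j *
      (oddSineIntegral (θ + excess h j) S - oddSineIntegral (θ + excess h j) S'))
      (oddSineSum h θ S - oddSineSum h θ S') := by
  simp_rw [mul_sub]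
  exact (summable_weight_mul_oddSineIntegral hh hθ hS).hasSum.sub
    (summable_weight_mul_oddSineIntegral hh hθ hS').hasSum

theorem weight_mul_oddSineIntegral_sub_nonneg (hh : 0 < h) (hθ : 0 ≤ θ)
    (hS : S ∈ Icc (-1 : ℝ) 1) (hS' : S' ∈ Icc (-1 : ℝ) 1) (hle : S' ≤ S) (j : ℕ) :
    0 ≤ weight h j *
      (oddSineIntegral (θ + excess h j) S - oddSineIntegral (θ + excess h j) S') :=
  mul_nonneg (weight_pos h j).le
    (sub_nonneg.2 (oddSineIntegral_mono (by linarith [excess_pos hh j]) hS hS' hle))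

/-- Every layer is increasing in `S`, so no layer can cancel another and each one bounds the whole
increment from below. -/
theorem weight_mul_oddSineIntegral_sub_le (hh : 0 < h) (hθ : 0 ≤ θ)
    (hS : S ∈ Icc (-1 : ℝ) 1) (hS' : S' ∈ Icc (-1 : ℝ) 1) (hle : S' ≤ S) (j : ℕ) :
    weight h j * (oddSineIntegral (θ + excess h j) S - oddSineIntegral (θ + excess h j) S')
      ≤ oddSineSum h θ S - oddSineSum h θ S' :=
  le_hasSum (hasSum_oddSineSum_sub hh hθ hS hS') j fun i _ =>
    weight_mul_oddSineIntegral_sub_nonneg hh hθ hS hS' hle i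

theorem oddSineSum_mono (hh : 0 < h) (hθ : 0 ≤ θ) (hS : S ∈ Icc (-1 : ℝ) 1)
    (hS' : S' ∈ Icc (-1 : ℝ) 1) (hle : S' ≤ S) : oddSineSum h θ S' ≤ oddSineSum h θ S :=
  sub_nonneg.1 ((hasSum_oddSineSum_sub hh hθ hS hS').nonneg
    (weight_mul_oddSineIntegral_sub_nonneg hh hθ hS hS' hle))

theorem exists_mul_le_oddSineSum_sub (hh : 0 < h) (hθ : 0 ≤ θ) :
    ∃ c, 0 < c ∧ ∀ S ∈ Icc (-1 : ℝ) 1, ∀ S' ∈ Icc (-1 : ℝ) 1, S' ≤ S →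
      c * (S - S') ≤ oddSineSum h θ S - oddSineSum h θ S' := by
  obtain ⟨c, hc, H⟩ := exists_mul_le_oddSineIntegral_sub
    (by linarith [excess_pos hh 0] : 0 < θ + excess h 0)
  refine ⟨weight h 0 * c, mul_pos (weight_pos h 0) hc, fun S hS S' hS' hle => ?_⟩
  rw [mul_assoc]
  exact (mul_le_mul_of_nonneg_left (H S hS S' hS' hle) (weight_pos h 0).le).trans
    (weight_mul_oddSineIntegral_sub_le hh hθ hS hS' hle 0)

/-- Apply the cut estimate to each layer with the same `r`, and sum: the shifted increments add up
to the increment `D` of the sum at `γ`, leaving `r^(γ-σ) + r^(-σ) D` up to constants. -/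
theorem oddSineSum_sub_le_rpow_of_sub_eq_mul {γ σ β : ℝ} (hh : 0 < h) (hh1 : h ≤ 1) (hγ : 0 < γ)
    (hσ : 0 ≤ σ) (hβ : 0 < β) (hγσ : γ - σ = γ * β) :
    ∃ C, 0 ≤ C ∧ ∀ S ∈ Icc (-1 : ℝ) 1, ∀ S' ∈ Icc (-1 : ℝ) 1, S' ≤ S →
      oddSineSum h (γ - σ) S - oddSineSum h (γ - σ) S'
        ≤ C * (oddSineSum h γ S - oddSineSum h γ S') ^ β := by
  have hp : 0 < γ - σ := hγσ ▸ mul_pos hγ hβ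
  obtain ⟨K, hK0, hK⟩ := oddSineIntegral_sub_le_add (b := γ - σ + h) hp hσ
  obtain ⟨c, hc, hlow⟩ := exists_mul_le_oddSineSum_sub hh hγ.le
  set B := ∑' q, oddCoeff h γ q with hB
  set W := ∑' j, weight h j with hW
  have hB0 : 0 ≤ B := tsum_nonneg (oddCoeff_nonneg h γ)
  have hW0 : 0 ≤ W := tsum_nonneg fun j => (weight_pos h j).le
  refine ⟨K * (1 + (2 * B) ^ (1 / γ)) * W + K, by positivity, fun S hS S' hS' hle => ?_⟩
  rcases hle.eq_or_lt with rfl | hlt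
  · simp [hβ.ne']
  set D := oddSineSum h γ S - oddSineSum h γ S' with hD
  have hD0 : 0 < D := (mul_pos hc (sub_pos.2 hlt)).trans_le (hlow S hS S' hS' hle)
  have hDB : D ≤ 2 * B := by
    linarith [(abs_le.1 (abs_oddSineSum_le hh hγ.le hS)).2,
      (abs_le.1 (abs_oddSineSum_le hh hγ.le hS')).1]
  -- This choice balances the two terms: since `γ - σ = γβ`, both `r^(γ-σ)` and `r^(-σ) D` equal
  -- `D^β`.
  set r := D ^ (1 / γ) with hr
  have hr0 : 0 < r := Real.rpow_pos_of_pos hD0 _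
  have hrB : r ≤ (2 * B) ^ (1 / γ) := Real.rpow_le_rpow hD0.le hDB (by positivity)
  have hrp : r ^ (γ - σ) = D ^ β := by
    rw [hr, ← Real.rpow_mul hD0.le, hγσ]
    congr 1
    field_simp
  have hrσ : r ^ (-σ) * D = D ^ β := by
    rw [hr, ← Real.rpow_mul hD0.le]
    nth_rewrite 2 [← Real.rpow_one D]
    rw [← Real.rpow_add hD0]
    congr 1
    field_simp
    linarith
  have hterm : ∀ j, weight h j * (oddSineIntegral (γ - σ + excess h j) S -
      oddSineIntegral (γ - σ + excess h j) S')
      ≤ weight h j * (K * (1 + (2 * B) ^ (1 / γ)) * D ^ β) + K * r ^ (-σ) *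
        (weight h j * (oddSineIntegral (γ + excess h j) S -
          oddSineIntegral (γ + excess h j) S')) := fun j => by
    have hη := excess_pos hh j
    have hη1 := excess_le hh j
    have h1 := hK (γ - σ + excess h j) ⟨by linarith, by linarith⟩ r hr0 S hS S' hS' hle
    rw [show γ - σ + excess h j + σ = γ + excess h j by ring, Real.rpow_add hr0, hrp] at h1
    -- The excess costs only a factor bounded uniformly in `j`, because `r` is bounded and the
    -- excess is at most `1`.
    have h2 : r ^ excess h j ≤ 1 + (2 * B) ^ (1 / γ) :=
      (rpow_le_one_add hr0.le hη.le (hη1.trans hh1)).trans (by linarith)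
    have h3 : K * (D ^ β * r ^ excess h j) ≤ K * (D ^ β * (1 + (2 * B) ^ (1 / γ))) :=
      mul_le_mul_of_nonneg_left (mul_le_mul_of_nonneg_left h2 (by positivity)) hK0
    have h4 := mul_le_mul_of_nonneg_left h1 (weight_pos h j).le
    have h5 := mul_le_mul_of_nonneg_left h3 (weight_pos h j).le
    linarith
  have hsum := ((summable_weight h).hasSum.mul_right (K * (1 + (2 * B) ^ (1 / γ)) * D ^ β)).add
    ((hasSum_oddSineSum_sub hh hγ.le hS hS').mul_left (K * r ^ (-σ)))
  refine (hasSum_le hterm (hasSum_oddSineSum_sub hh hp.le hS hS') hsum).trans (le_of_eq ?_)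
  rw [← hD, mul_assoc K (r ^ (-σ)), hrσ]
  ring

/-- Each layer of exponent `β + η_j < 1` has increments `O((S-S')^β)` uniformly in `j`, and `S - S'`
is controlled by the increment at `γ` through `exists_mul_le_oddSineSum_sub`. -/
theorem oddSineSum_sub_le_rpow_of_sub_eq {γ σ β : ℝ} (hh : 0 < h) (hβh : β + h < 1) (hγ : 0 ≤ γ)
    (hβ : 0 < β) (hγσ : γ - σ = β) :
    ∃ C, 0 ≤ C ∧ ∀ S ∈ Icc (-1 : ℝ) 1, ∀ S' ∈ Icc (-1 : ℝ) 1, S' ≤ S →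
      oddSineSum h (γ - σ) S - oddSineSum h (γ - σ) S'
        ≤ C * (oddSineSum h γ S - oddSineSum h γ S') ^ β := by
  rw [hγσ]
  obtain ⟨K, hK0, hK⟩ := oddSineIntegral_sub_le_rpow (a := β) hβ hβh
  obtain ⟨c, hc, hlow⟩ := exists_mul_le_oddSineSum_sub hh hγ
  set W := ∑' j, weight h j with hW
  have hW0 : 0 ≤ W := tsum_nonneg fun j => (weight_pos h j).le
  refine ⟨W * (K * 3) * (1 / c) ^ β, by positivity, fun S hS S' hS' hle => ?_⟩
  have hd : 0 ≤ S - S' := sub_nonneg.2 hle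
  have hterm : ∀ j, weight h j * (oddSineIntegral (β + excess h j) S -
      oddSineIntegral (β + excess h j) S') ≤ weight h j * (K * 3 * (S - S') ^ β) := fun j => by
    have hη := excess_pos hh j
    have hη1 := excess_le hh j
    refine mul_le_mul_of_nonneg_left ((hK _ ⟨by linarith, by linarith⟩ S hS S' hS' hle).trans ?_)
      (weight_pos h j).le
    rw [Real.rpow_add_of_nonneg hd hβ.le hη.le, mul_assoc K, mul_comm 3]
    refine mul_le_mul_of_nonneg_left (mul_le_mul_of_nonneg_left ?_ (by positivity)) hK0
    exact (rpow_le_one_add hd hη.le (by linarith)).trans (by linarith [hS.2, hS'.1])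
  refine (hasSum_le hterm (hasSum_oddSineSum_sub hh hβ.le hS hS')
    ((summable_weight h).hasSum.mul_right _)).trans ?_
  have h1 : S - S' ≤ 1 / c * (oddSineSum h γ S - oddSineSum h γ S') := by
    rw [one_div_mul_eq_div, le_div_iff₀ hc, mul_comm]
    exact hlow S hS S' hS' hle
  have h2 := Real.rpow_le_rpow hd h1 hβ.le
  rw [Real.mul_rpow (by positivity) (sub_nonneg.2 (oddSineSum_mono hh hγ hS hS' hle))] at h2
  have h3 := mul_le_mul_of_nonneg_left h2 (by positivity : 0 ≤ W * (K * 3))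
  linarith

end Comparison

/-! ### The periodic solution and its nonlinearity. -/

section Series

variable {ω h γ : ℝ}

theorem sin_mem_Icc (x : ℝ) : Real.sin x ∈ Icc (-1 : ℝ) 1 :=
  ⟨Real.neg_one_le_sin x, Real.sin_le_one x⟩

theorem oddSeries_eq (hh : 0 < h) (hγ : 0 ≤ γ) (x : ℝ) :
    trigSeries (oddCoeff h γ) (oddFreq ω) 0 x = oddSineSum h γ (Real.sin (ω * x)) := by
  rw [← tsum_oddCoeff_mul_sin hh hγ, trigSeries]
  refine tsum_congr fun q => ?_
  simp only [oddFreq, pow_zero, mul_one, Nat.cast_zero, zero_mul, add_zero]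
  congr 2
  ring

theorem periodic_oddSeries {L : ℝ} (hL : 0 < L) (hh : 0 < h) (hγ : 0 ≤ γ) :
    Function.Periodic (trigSeries (oddCoeff h γ) (oddFreq (Real.pi / L)) 0) (2 * L) := by
  intro x
  rw [oddSeries_eq hh hγ, oddSeries_eq hh hγ,
    show Real.pi / L * (x + 2 * L) = Real.pi / L * x + 2 * Real.pi by field_simp, Real.sin_add_two_pi]

theorem hasFracLaplacian_oddSeries {s : ℝ} (hs0 : 0 < s) (hs1 : s < 1) (hω : 0 < ω) (hh : 0 < h)
    (hγ : 2 * s ≤ γ) (x : ℝ) :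
    HasFracLaplacian s (trigSeries (oddCoeff h γ) (oddFreq ω) 0) x
      (fracLaplacianConst s * (∫ t : ℝ, (1 - Real.cos t) / |t| ^ (1 + 2 * s)) * ω ^ (2 * s) *
        oddSineSum h (γ - 2 * s) (Real.sin (ω * x))) := by
  have hγ0 : 0 ≤ γ := by linarith
  have heq := oddCoeff_mul_oddFreq_rpow hω h γ (2 * s)
  have H := hasFracLaplacian_trigSeries hs0 hs1 (oddCoeff_nonneg h γ) (oddFreq_pos hω)
    (summable_oddCoeff hh hγ0) (by
      simp_rw [heq]
      exact (summable_oddCoeff hh (sub_nonneg.2 hγ)).mul_left _) x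
  convert H using 1
  rw [mul_assoc _ (ω ^ (2 * s)), ← tsum_oddCoeff_mul_sin hh (sub_nonneg.2 hγ), ← tsum_mul_left]
  congr 1
  refine tsum_congr fun q => ?_
  rw [heq, oddFreq, ← mul_assoc, show ω * (2 * (q.2 : ℝ) + 1) * x = (2 * q.2 + 1) * (ω * x) by ring]

theorem exists_isHolder_oddSeries {s β : ℝ} (hs0 : 0 < s) (hs1 : s < 1) (hβ0 : 0 < β) (hβ1 : β < 1)
    (hω : 0 < ω) (hh : 0 < h) (hγ : 2 * s ≤ γ)
    (H : ∃ C, 0 ≤ C ∧ ∀ S ∈ Icc (-1 : ℝ) 1, ∀ S' ∈ Icc (-1 : ℝ) 1, S' ≤ S →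
      oddSineSum h (γ - 2 * s) S - oddSineSum h (γ - 2 * s) S'
        ≤ C * (oddSineSum h γ S - oddSineSum h γ S') ^ β) :
    ∃ f : ℝ → ℝ, IsHolder β univ f ∧
      ∀ x, HasFracLaplacian s (trigSeries (oddCoeff h γ) (oddFreq ω) 0) x
        (f (trigSeries (oddCoeff h γ) (oddFreq ω) 0 x)) := by
  obtain ⟨C, hC, H⟩ := H
  have hγ0 : 0 ≤ γ := by linarith
  have hp : 0 ≤ γ - 2 * s := sub_nonneg.2 hγ
  set A := fracLaplacianConst s * (∫ t : ℝ, (1 - Real.cos t) / |t| ^ (1 + 2 * s)) * ω ^ (2 * s)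
    with hA
  have hH : ∀ S ∈ Icc (-1 : ℝ) 1, ∀ S' ∈ Icc (-1 : ℝ) 1,
      |oddSineSum h (γ - 2 * s) S - oddSineSum h (γ - 2 * s) S'|
        ≤ C * |oddSineSum h γ S - oddSineSum h γ S'| ^ β := by
    intro S hS S' hS'
    wlog hle : S' ≤ S generalizing S S'
    · rw [abs_sub_comm, abs_sub_comm (oddSineSum h γ S)]
      exact this S' hS' S hS (le_of_not_ge hle)
    rw [abs_of_nonneg (sub_nonneg.2 (oddSineSum_mono hh hp hS hS' hle)),
      abs_of_nonneg (sub_nonneg.2 (oddSineSum_mono hh hγ0 hS hS' hle))]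
    exact H S hS S' hS' hle
  obtain ⟨f, hf, hfg⟩ := exists_isHolder_comp_eq (X := ℝ) (β := β)
    (u := trigSeries (oddCoeff h γ) (oddFreq ω) 0)
    (g := fun x => A * oddSineSum h (γ - 2 * s) (Real.sin (ω * x))) (C := |A| * C)
    (M := |A| * ∑' q, oddCoeff h (γ - 2 * s) q) hβ0 hβ1 (by positivity)
    (fun x => by
      rw [abs_mul]
      exact mul_le_mul_of_nonneg_left (abs_oddSineSum_le hh hp (sin_mem_Icc _)) (abs_nonneg A))
    (fun x y => by
      rw [← mul_sub, abs_mul, oddSeries_eq hh hγ0, oddSeries_eq hh hγ0, mul_assoc]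
      exact mul_le_mul_of_nonneg_left (hH _ (sin_mem_Icc _) _ (sin_mem_Icc _)) (abs_nonneg A))
  refine ⟨f, hf, fun x => ?_⟩
  rw [hfg]
  exact hasFracLaplacian_oddSeries hs0 hs1 hω hh hγ x

end Series

/-! ### Sharpness of the regularity at the origin. -/

section Singularity

variable {ω h γ : ℝ}

theorem one_sub_cos_nonneg (x : ℝ) : 0 ≤ 1 - Real.cos x := sub_nonneg.2 (Real.cos_le_one x)

theorem oddSineIntegral_nonneg {θ S : ℝ} (hθ : 0 < θ) (hS : S ∈ Icc (0 : ℝ) 1) :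
    0 ≤ oddSineIntegral θ S := by
  have h := oddSineIntegral_mono hθ (S := S) (S' := 0) ⟨by linarith [hS.1], hS.2⟩
    (by simp) hS.1
  simpa [oddSineIntegral] using h

theorem weight_mul_le_oddSineSum {θ S : ℝ} (hh : 0 < h) (hθ : 0 ≤ θ) (hS : S ∈ Icc (0 : ℝ) 1)
    (j : ℕ) : weight h j * oddSineIntegral (θ + excess h j) S ≤ oddSineSum h θ S :=
  (summable_weight_mul_oddSineIntegral hh hθ ⟨by linarith [hS.1], hS.2⟩).le_tsum j fun i _ =>
    mul_nonneg (weight_pos h i).le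
      (oddSineIntegral_nonneg (by linarith [excess_pos hh i]) hS)

/-- Lower bound for the cosine series at the scale of the frequencies between `2 N` and `4 N`. -/
theorem exists_mul_rpow_le_tsum_one_sub_cos {θ : ℝ} (hh : 0 < h) (hθ : 0 ≤ θ) (j : ℕ) :
    ∃ c, 0 < c ∧ ∀ N : ℕ, 0 < N → c * (1 / (2 * N : ℝ)) ^ (θ + excess h j)
      ≤ ∑' q : ℕ × ℕ, oddCoeff h θ q * (1 - Real.cos ((2 * q.2 + 1) * (1 / (2 * N)))) := by
  set p := θ + excess h j with hp
  have hp0 : 0 < p := by linarith [excess_pos hh j]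
  refine ⟨weight h j * (4 / 9 / 2 * 2 ^ (-1 - p)), mul_pos (weight_pos h j) (by positivity),
    fun N hN => ?_⟩
  have hN0 : (0 : ℝ) < N := by exact_mod_cast hN
  have hnn : ∀ q : ℕ × ℕ,
      0 ≤ oddCoeff h θ q * (1 - Real.cos ((2 * q.2 + 1) * (1 / (2 * N)))) := fun q =>
    mul_nonneg (oddCoeff_nonneg h θ q) (one_sub_cos_nonneg _)
  have hsum : Summable fun q : ℕ × ℕ =>
      oddCoeff h θ q * (1 - Real.cos ((2 * q.2 + 1) * (1 / (2 * N)))) :=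
    ((summable_oddCoeff hh hθ).mul_right 2).of_nonneg_of_le hnn fun q =>
      mul_le_mul_of_nonneg_left (by linarith [Real.neg_one_le_cos ((2 * q.2 + 1) * (1 / (2 * N)))])
        (oddCoeff_nonneg h θ q)
  have hinj : Function.Injective fun i : ℕ => (j, i) := fun a b hab => by simpa using hab
  -- All terms are nonnegative, so it suffices to keep layer `j` and `N ≤ i < 2N`, for which the
  -- argument of the cosine lies in `[1, π]`.
  refine le_trans ?_ (hsum.sum_le_tsum ((Finset.Ico N (2 * N)).image fun i => (j, i))
    fun q _ => hnn q)
  rw [Finset.sum_image hinj.injOn]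
  have hterm : ∀ i ∈ Finset.Ico N (2 * N), weight h j * (4 * N : ℝ) ^ (-1 - p) * (4 / 9)
      ≤ oddCoeff h θ (j, i) * (1 - Real.cos ((2 * i + 1) * (1 / (2 * N)))) := fun i hi => by
    obtain ⟨h1, h2⟩ := Finset.mem_Ico.1 hi
    have h1' : (N : ℝ) ≤ i := by exact_mod_cast h1
    have h2' : (i : ℝ) + 1 ≤ 2 * N := by exact_mod_cast h2
    have hy1 : 1 ≤ (2 * i + 1 : ℝ) * (1 / (2 * N)) := by
      rw [mul_one_div, le_div_iff₀ (by positivity)]; linarith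
    have hy2 : (2 * i + 1 : ℝ) * (1 / (2 * N)) ≤ Real.pi := by
      rw [mul_one_div, div_le_iff₀ (by positivity)]
      nlinarith [Real.pi_gt_three]
    -- As `cos 1 ≤ 5/9`, each kept term has `1 - cos ≥ 4/9`.
    have hcos := (Real.cos_le_cos_of_nonneg_of_le_pi zero_le_one hy2 hy1).trans Real.cos_one_le
    refine mul_le_mul ?_ (by linarith) (by norm_num) (oddCoeff_nonneg _ _ _)
    refine mul_le_mul_of_nonneg_left ?_ (weight_pos h j).le
    rw [show -1 - θ - excess h (j, i).1 = -1 - p by simp only [hp]; ring]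
    exact Real.rpow_le_rpow_of_nonpos (by positivity) (by simp only; linarith) (by linarith)
  refine le_trans (le_of_eq ?_) (Finset.sum_le_sum hterm)
  rw [Finset.sum_const, Nat.card_Ico, nsmul_eq_mul, show 2 * N - N = N by omega,
    show (4 * N : ℝ) = 2 * (2 * N) by ring, Real.mul_rpow (by norm_num) (by positivity),
    one_div, Real.inv_rpow (by positivity), ← Real.rpow_neg (by positivity),
    show (2 * N : ℝ) ^ (-1 - p) = (2 * N : ℝ) ^ (-p) / (2 * N) by
      rw [show -1 - p = -p - 1 by ring, Real.rpow_sub_one (by positivity)]]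
  field_simp

/-- Since `γ < 3`, the order `⌊γ⌋` is `0`, `1` or `2`. For even order the derivative is, up to sign,
again a sine series, bounded below through its integral representation. For order `1` it is a cosine
series, and its increment from `0` is minus a sum of nonnegative terms `1 - cos`. -/
theorem exists_mul_rpow_le_abs_iteratedDeriv_oddSeries_sub (hω : 0 < ω) (hh : 0 < h) (hγ : 0 ≤ γ)
    (hγ3 : γ < 3) (j : ℕ) :
    ∃ c, 0 < c ∧ ∀ N : ℕ, 0 < N → c * (1 / (2 * N * ω)) ^ (γ - ⌊γ⌋₊ + excess h j) ≤
      |iteratedDeriv ⌊γ⌋₊ (trigSeries (oddCoeff h γ) (oddFreq ω) 0) (1 / (2 * N * ω))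
        - iteratedDeriv ⌊γ⌋₊ (trigSeries (oddCoeff h γ) (oddFreq ω) 0) 0| := by
  have hfl : (⌊γ⌋₊ : ℝ) ≤ γ := Nat.floor_le hγ
  have hm3 : ⌊γ⌋₊ < 3 := (Nat.floor_lt hγ).2 (by exact_mod_cast hγ3)
  rw [iteratedDeriv_trigSeries (oddCoeff_nonneg h γ) (fun q => (oddFreq_pos hω q).le)
    (fun n hn => summable_oddCoeff_mul_oddFreq_pow hω hh ((Nat.cast_le.2 hn).trans hfl)) le_rfl]
  generalize hm : ⌊γ⌋₊ = m at *
  set θ := γ - m with hθdef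
  have hθ : 0 ≤ θ := sub_nonneg.2 hfl
  have hη := excess_pos hh j
  have hx : ∀ N : ℕ, 0 < N → ∀ q : ℕ × ℕ,
      oddFreq ω q * (1 / (2 * N * ω)) = (2 * q.2 + 1) * (1 / (2 * N)) := fun N hN q => by
    have : (N : ℝ) ≠ 0 := by exact_mod_cast hN.ne'
    rw [oddFreq]
    field_simp
  have hpow : ∀ N : ℕ, 0 < N → (1 / (2 * N * ω)) ^ (θ + excess h j)
      = (1 / ω) ^ (θ + excess h j) * (1 / (2 * N : ℝ)) ^ (θ + excess h j) := fun N hN => by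
    rw [← Real.mul_rpow (by positivity) (by positivity), one_div_mul_one_div, mul_comm ω]
  suffices H : ∃ c, 0 < c ∧ ∀ N : ℕ, 0 < N → c * (1 / (2 * N : ℝ)) ^ (θ + excess h j) ≤
      |trigSeries (oddCoeff h γ) (oddFreq ω) m (1 / (2 * N * ω))
        - trigSeries (oddCoeff h γ) (oddFreq ω) m 0| by
    obtain ⟨c, hc, H⟩ := H
    refine ⟨c / (1 / ω) ^ (θ + excess h j), by positivity, fun N hN => le_trans (le_of_eq ?_) (H N hN)⟩
    rw [hpow N hN]
    have : (1 / ω) ^ (θ + excess h j) ≠ 0 := (Real.rpow_pos_of_pos (by positivity) _).ne'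
    field_simp
  have hcoef : ∀ q, oddCoeff h γ q * oddFreq ω q ^ m = ω ^ m * oddCoeff h θ q :=
    oddCoeff_mul_oddFreq_pow hω h γ m
  have hsine : ∃ c, 0 < c ∧ ∀ N : ℕ, 0 < N → c * (1 / (2 * N : ℝ)) ^ (θ + excess h j) ≤
      ω ^ m * oddSineSum h θ (Real.sin (1 / (2 * N))) := by
    obtain ⟨c, hc, H⟩ := exists_mul_rpow_le_oddSineIntegral
      (by linarith : 0 < θ + excess h j)
    refine ⟨ω ^ m * (weight h j * c), mul_pos (by positivity) (mul_pos (weight_pos h j) hc),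
      fun N hN => ?_⟩
    have hN1 : (1 : ℝ) ≤ N := by exact_mod_cast hN
    have hy0 : 0 ≤ 1 / (2 * N : ℝ) := by positivity
    have hy1 : 1 / (2 * N : ℝ) ≤ 1 := by
      rw [div_le_one (by positivity)]; linarith
    have hsin : Real.sin (1 / (2 * N)) ∈ Icc (0 : ℝ) 1 :=
      ⟨Real.sin_nonneg_of_nonneg_of_le_pi hy0 (by linarith [Real.pi_gt_three]), Real.sin_le_one _⟩
    rw [mul_assoc, mul_assoc]
    exact mul_le_mul_of_nonneg_left ((mul_le_mul_of_nonneg_left (H _ hy0 hy1)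
      (weight_pos h j).le).trans (weight_mul_le_oddSineSum hh hθ hsin j)) (by positivity)
  have hsum0 : ∀ x, Summable fun q : ℕ × ℕ =>
      oddCoeff h γ q * oddFreq ω q ^ m * Real.sin (oddFreq ω q * x + m * (Real.pi / 2)) :=
    summable_trigSeries_term (oddCoeff_nonneg h γ) (fun q => (oddFreq_pos hω q).le)
      (summable_oddCoeff_mul_oddFreq_pow hω hh hfl)
  have hdiff : ∀ N : ℕ, 0 < N → trigSeries (oddCoeff h γ) (oddFreq ω) m (1 / (2 * N * ω))
        - trigSeries (oddCoeff h γ) (oddFreq ω) m 0 = ω ^ m * ∑' q : ℕ × ℕ, oddCoeff h θ q *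
        (Real.sin ((2 * q.2 + 1) * (1 / (2 * N)) + m * (Real.pi / 2))
          - Real.sin (m * (Real.pi / 2))) := fun N hN => by
    rw [trigSeries, trigSeries, ← (hsum0 _).tsum_sub (hsum0 _), ← tsum_mul_left]
    refine tsum_congr fun q => ?_
    rw [hcoef, hx N hN, mul_zero, zero_add]
    ring
  interval_cases m
  · obtain ⟨c, hc, H⟩ := hsine
    refine ⟨c, hc, fun N hN => (H N hN).trans ((le_of_eq ?_).trans (le_abs_self _))⟩
    rw [hdiff N hN, ← tsum_oddCoeff_mul_sin hh hθ]
    simp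
  · obtain ⟨c, hc, H⟩ := exists_mul_rpow_le_tsum_one_sub_cos hh hθ j
    refine ⟨ω * c, mul_pos hω hc, fun N hN => ?_⟩
    rw [mul_assoc]
    refine (mul_le_mul_of_nonneg_left (H N hN) hω.le).trans
      ((le_of_eq ?_).trans (neg_le_abs _))
    rw [hdiff N hN, pow_one, ← mul_neg, ← tsum_neg]
    congr 1
    refine tsum_congr fun q => ?_
    rw [Nat.cast_one, one_mul, Real.sin_add_pi_div_two, Real.sin_pi_div_two]
    ring
  · obtain ⟨c, hc, H⟩ := hsine
    refine ⟨c, hc, fun N hN => (H N hN).trans ((le_of_eq ?_).trans (neg_le_abs _))⟩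
    rw [hdiff N hN, ← mul_neg, ← tsum_neg, ← tsum_oddCoeff_mul_sin hh hθ]
    congr 1
    refine tsum_congr fun q => ?_
    rw [Nat.cast_ofNat, mul_div_cancel₀ _ two_ne_zero, Real.sin_add_pi, Real.sin_pi]
    ring

theorem not_isHolder_oddSeries (hω : 0 < ω) (hh : 0 < h) (hγ : 0 ≤ γ) (hγ3 : γ < 3) {ε ρ : ℝ}
    (hε : 0 < ε) (hρ : 0 < ρ) :
    ¬ IsHolder (γ + ε) (Icc (-ρ) ρ) (trigSeries (oddCoeff h γ) (oddFreq ω) 0) := by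
  intro hH
  have hcd : ContDiff ℝ ⌊γ⌋₊ (trigSeries (oddCoeff h γ) (oddFreq ω) 0) :=
    contDiff_trigSeries (oddCoeff_nonneg h γ) (fun q => (oddFreq_pos hω q).le)
      fun n hn => summable_oddCoeff_mul_oddFreq_pow hω hh
        ((Nat.cast_le.2 hn).trans (Nat.floor_le hγ))
  obtain ⟨δ, C, hδ, hC, hup⟩ := hH.exists_abs_iteratedDeriv_sub_le hγ hε hρ hcd
  obtain ⟨j, hj⟩ := exists_excess_lt h hδ
  obtain ⟨c, hc, hlow⟩ := exists_mul_rpow_le_abs_iteratedDeriv_oddSeries_sub hω hh hγ hγ3 j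
  have hx : Tendsto (fun N : ℕ => 1 / (2 * N * ω)) atTop (𝓝 0) := by
    have := (tendsto_one_div_atTop_nhds_zero_nat (𝕜 := ℝ)).mul_const (1 / (2 * ω))
    rw [zero_mul] at this
    refine this.congr fun N => ?_
    rw [one_div_mul_one_div]
    ring
  -- Ratio of the assumed upper bound to the lower bound of layer `j`, up to `c`; it tends to `0`
  -- because `j` was chosen with excess below `δ`.
  have hlim : Tendsto (fun N : ℕ => C * (1 / (2 * N * ω)) ^ (δ - excess h j)) atTop (𝓝 0) := by
    have hr : 0 < δ - excess h j := sub_pos.2 hj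
    simpa [Real.zero_rpow hr.ne'] using (hx.rpow_const (Or.inr hr.le)).const_mul C
  obtain ⟨N, hN1, hN2, hN3⟩ := ((hx.eventually (eventually_le_nhds hρ)).and
    ((hlim.eventually (eventually_lt_nhds hc)).and (eventually_gt_atTop 0))).exists
  have hN0 : (0 : ℝ) < N := by exact_mod_cast hN3
  have hpos : 0 < 1 / (2 * N * ω) := by positivity
  have h1 := (hlow N hN3).trans (hup _ hpos.le hN1)
  rw [show γ - ⌊γ⌋₊ + δ = (δ - excess h j) + (γ - ⌊γ⌋₊ + excess h j) by ring,
    Real.rpow_add hpos (δ - excess h j), ← mul_assoc] at h1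
  exact absurd (le_of_mul_le_mul_right h1 (Real.rpow_pos_of_pos hpos _)) (not_le.2 hN2)

end Singularity

/-! ### The two cases of the theorem. -/

theorem theorem1p2 (s β L : ℝ) (hs0 : 0 < s) (hs1 : s < 1) (hβ0 : 0 < β) (hβ1 : β < 1)
    (hL : 0 < L) :
    (2 * s ≤ 1 - β →
      ∃ u : ℝ → ℝ, IsHolder (2 * s / (1 - β)) Set.univ u ∧
        Function.Periodic u (2 * L) ∧
        (∃ f : ℝ → ℝ, IsHolder β Set.univ f ∧ ∀ x : ℝ, HasFracLaplacian s u x (f (u x))) ∧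
        ∀ ε ρ : ℝ, 0 < ε → 0 < ρ →
          ¬ IsHolder (2 * s / (1 - β) + ε) (Set.Icc (-ρ) ρ) u) ∧
    (1 - β < 2 * s →
      ∃ u : ℝ → ℝ, IsHolder (2 * s + β) Set.univ u ∧
        Function.Periodic u (2 * L) ∧
        (∃ f : ℝ → ℝ, IsHolder β Set.univ f ∧ ∀ x : ℝ, HasFracLaplacian s u x (f (u x))) ∧
        ∀ ε ρ : ℝ, 0 < ε → 0 < ρ →
          ¬ IsHolder (2 * s + β + ε) (Set.Icc (-ρ) ρ) u) := by
  have hω : 0 < Real.pi / L := by positivity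
  have hβ1' : 0 < 1 - β := by linarith
  -- The parameter `h = (1-β)/2` satisfies `h ≤ 1`, needed in (i), and `β + h < 1`, needed in (ii).
  have hh : 0 < (1 - β) / 2 := by linarith
  have hh1 : (1 - β) / 2 ≤ 1 := by linarith
  refine ⟨fun hle => ?_, fun _ => ?_⟩
  · have hγ0 : 0 < 2 * s / (1 - β) := by positivity
    have hγ1 : 2 * s / (1 - β) ≤ 1 := (div_le_one hβ1').2 hle
    have hγσ : 2 * s / (1 - β) - 2 * s = 2 * s / (1 - β) * β := by field_simp; ring
    have hγ : 2 * s ≤ 2 * s / (1 - β) := by linarith [mul_pos hγ0 hβ0]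
    exact ⟨_, isHolder_oddSeries hω hh hγ0.le, periodic_oddSeries hL hh hγ0.le,
      exists_isHolder_oddSeries hs0 hs1 hβ0 hβ1 hω hh hγ
        (oddSineSum_sub_le_rpow_of_sub_eq_mul hh hh1 hγ0 (by linarith) hβ0 hγσ),
      fun ε ρ hε hρ => not_isHolder_oddSeries hω hh hγ0.le (by linarith) hε hρ⟩
  · have hγ0 : 0 ≤ 2 * s + β := by linarith
    exact ⟨_, isHolder_oddSeries hω hh hγ0, periodic_oddSeries hL hh hγ0,
      exists_isHolder_oddSeries hs0 hs1 hβ0 hβ1 hω hh (by linarith)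
        (oddSineSum_sub_le_rpow_of_sub_eq hh (by linarith) hγ0 hβ0 (by ring)),
      fun ε ρ hε hρ => not_isHolder_oddSeries hω hh hγ0 (by linarith) hε hρ⟩
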